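/- Let $h,k\ge 0$ be integers and let $M$ be a smooth manifold of dimension $2h+2k+2$; all objects are smooth. Let $(\alpha_1,\alpha_2)$ be a contact pair of type $(h,k)$ on $M$, i.e. $\alpha_1,\alpha_2$ are $1$-forms such that $\alpha_1\wedge(d\alpha_1)^h\wedge\alpha_2\wedge(d\alpha_2)^k$ is a volume form, $(d\alpha_1)^{h+1}=0$ and $(d\alpha_2)^{k+1}=0$. Let $Z_1,Z_2$ be its Reeb vector fields, i.e. the vector fields uniquely determined by $\alpha_i(Z_j)=\delta_{ij}$ and $i_{Z_j}d\alpha_i=0$ for $i,j\in\{1,2\}$. Let $\phi$ be a field of endomorphisms of $TM$ such that $$\phi^2=-\mathrm{Id}+\alpha_1\otimes Z_1+\alpha_2\otimes Z_2,\qquad \phi(Z_1)=\phi(Z_2)=0,$$ so that $(\alpha_1,\alpha_2,\phi)$ is a contact pair structure. Assume that $\phi$ is decomposable, i.e. $\phi$ maps $\ker\alpha_i\cap\ker d\alpha_i$ into itself for $i=1,2$ (where $\ker d\alpha_i=\{v : i_v d\alpha_i=0\}$). Consider the almost complex structures $$J=\phi-\alpha_2\otimes Z_1+\alpha_1\otimes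 Z_2,\qquad T=\phi+\alpha_2\otimes Z_1-\alpha_1\otimes Z_2,$$ associated to $(\alpha_1,\alpha_2,\phi)$ and to $(\alpha_2,\alpha_1,\phi)$ respectively. An almost complex structure is called integrable if its Nijenhuis tensor vanishes identically. Suppose that $J$ is integrable. Then the following properties are equivalent: 1. $T$ is integrable; 2. $L_{Z_1}\phi=0$; 3. $L_{Z_2}\phi=0$. -/

import Mathlib

open scoped Manifold ContDiff

noncomputable section

/-! ### Exterior algebra at a point -/

/-- The wedge product of two real alternating forms (the signed sum over shuffles). -/
def wedge {V : Type*} [AddCommGroup V] [Module ℝ V] {p q : ℕ}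
    (a : V [⋀^Fin p]→ₗ[ℝ] ℝ) (b : V [⋀^Fin q]→ₗ[ℝ] ℝ) : V [⋀^Fin (p + q)]→ₗ[ℝ] ℝ :=
  ((LinearMap.mul' ℝ ℝ).compAlternatingMap (a.domCoprod b)).domDomCongr finSumFinEquiv

/-- The `n`-th wedge power of a `2`-form, with zeroth power `1`. -/
def wedgePow {V : Type*} [AddCommGroup V] [Module ℝ V] (η : V [⋀^Fin 2]→ₗ[ℝ] ℝ) :
    (n : ℕ) → V [⋀^Fin (2 * n)]→ₗ[ℝ] ℝ
  | 0 => AlternatingMap.constOfIsEmpty ℝ V (Fin 0) 1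
  | n + 1 => wedge (wedgePow η n) η

/-- A linear form, regarded as an alternating `1`-form. -/
def oneForm {V : Type*} [AddCommGroup V] [Module ℝ V] (a : V →ₗ[ℝ] ℝ) : V [⋀^Fin 1]→ₗ[ℝ] ℝ :=
  AlternatingMap.ofSubsingleton ℝ V ℝ (0 : Fin 1) a

/-! ### Tensor calculus on a smooth manifold modelled on `E` -/

section Manifold

variable {E : Type*} [NormedAddCommGroup E] [NormedSpace ℝ E]
  {M : Type*} [TopologicalSpace M] [ChartedSpace E M]

/-- A vector field is smooth if it is a smooth section of the tangent bundle. -/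
def SmoothVectorField [IsManifold 𝓘(ℝ, E) ∞ M] (X : Π x : M, TangentSpace 𝓘(ℝ, E) x) : Prop :=
  ContMDiff 𝓘(ℝ, E) (𝓘(ℝ, E).prod 𝓘(ℝ, E)) ∞
    (fun x ↦ Bundle.TotalSpace.mk' E (E := fun x : M ↦ TangentSpace 𝓘(ℝ, E) x) x (X x))

/-- A `1`-form is smooth if it is a smooth section of the cotangent bundle. -/
def SmoothOneForm [IsManifold 𝓘(ℝ, E) ∞ M]
    (α : Π x : M, TangentSpace 𝓘(ℝ, E) x →L[ℝ] ℝ) : Prop :=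
  ContMDiff 𝓘(ℝ, E) (𝓘(ℝ, E).prod 𝓘(ℝ, E →L[ℝ] ℝ)) ∞
    (fun x ↦ Bundle.TotalSpace.mk' (E →L[ℝ] ℝ)
      (E := fun x : M ↦ TangentSpace 𝓘(ℝ, E) x →L[ℝ] Bundle.Trivial M ℝ x) x (α x))

/-- A field of endomorphisms of the tangent bundle (a tensor field of type `(1,1)`) is smooth
if it is a smooth section of the endomorphism bundle. -/
def SmoothEndo [IsManifold 𝓘(ℝ, E) ∞ M]
    (φ : Π x : M, TangentSpace 𝓘(ℝ, E) x →L[ℝ] TangentSpace 𝓘(ℝ, E) x) : Prop :=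
  ContMDiff 𝓘(ℝ, E) (𝓘(ℝ, E).prod 𝓘(ℝ, E →L[ℝ] E)) ∞
    (fun x ↦ Bundle.TotalSpace.mk' (E →L[ℝ] E)
      (E := fun x : M ↦ TangentSpace 𝓘(ℝ, E) x →L[ℝ] TangentSpace 𝓘(ℝ, E) x) x (φ x))

/-- The representation of a `1`-form in the preferred chart at `x₀`: its pullback under the
inverse of the chart, a `1`-form on (an open subset of) the model space. -/
def oneFormInChart (α : Π x : M, TangentSpace 𝓘(ℝ, E) x →L[ℝ] ℝ) (x₀ : M) (y : E) :
    E [⋀^Fin 1]→L[ℝ] ℝ :=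
  ContinuousAlternatingMap.ofSubsingleton ℝ E ℝ (0 : Fin 1)
    ((α ((extChartAt 𝓘(ℝ, E) x₀).symm y)).comp
      (mfderiv 𝓘(ℝ, E) 𝓘(ℝ, E) (extChartAt 𝓘(ℝ, E) x₀).symm y))

/-- The exterior derivative `dα` of a `1`-form at `x`: take the exterior derivative of the
representation in the chart at `x` and pull it back by the chart. The normalization is
`dα (X, Y) = X (α Y) - Y (α X) - α [X, Y]`. -/
def dOneForm (α : Π x : M, TangentSpace 𝓘(ℝ, E) x →L[ℝ] ℝ) (x : M) :
    TangentSpace 𝓘(ℝ, E) x [⋀^Fin 2]→ₗ[ℝ] ℝ :=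
  ((extDeriv (oneFormInChart α x) (extChartAt 𝓘(ℝ, E) x x)).compContinuousLinearMap
    (mfderiv 𝓘(ℝ, E) 𝓘(ℝ, E) (extChartAt 𝓘(ℝ, E) x) x)).toAlternatingMap

/-- The contraction `i_v η` of a `2`-form with a vector. -/
def contract {V : Type*} [AddCommGroup V] [Module ℝ V] (v : V) (η : V [⋀^Fin 2]→ₗ[ℝ] ℝ) :
    V [⋀^Fin 1]→ₗ[ℝ] ℝ :=
  η.curryLeft v

/-- The Nijenhuis tensor
`[A, A] (X, Y) = A² [X, Y] + [A X, A Y] - A [A X, Y] - A [X, A Y]`. -/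
def nijenhuis (A : Π x : M, TangentSpace 𝓘(ℝ, E) x →L[ℝ] TangentSpace 𝓘(ℝ, E) x)
    (X Y : Π x : M, TangentSpace 𝓘(ℝ, E) x) (x : M) : TangentSpace 𝓘(ℝ, E) x :=
  A x (A x (VectorField.mlieBracket 𝓘(ℝ, E) X Y x))
    + VectorField.mlieBracket 𝓘(ℝ, E) (fun y ↦ A y (X y)) (fun y ↦ A y (Y y)) x
    - A x (VectorField.mlieBracket 𝓘(ℝ, E) (fun y ↦ A y (X y)) Y x)
    - A x (VectorField.mlieBracket 𝓘(ℝ, E) X (fun y ↦ A y (Y y)) x)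

/-- An almost complex structure is integrable if its Nijenhuis tensor vanishes identically. -/
def IsIntegrable [IsManifold 𝓘(ℝ, E) ∞ M]
    (J : Π x : M, TangentSpace 𝓘(ℝ, E) x →L[ℝ] TangentSpace 𝓘(ℝ, E) x) : Prop :=
  ∀ X Y : Π x : M, TangentSpace 𝓘(ℝ, E) x, SmoothVectorField X → SmoothVectorField Y →
    ∀ x : M, nijenhuis J X Y x = 0

/-- The Lie derivative of a field of endomorphisms, `(L_Z φ) (X) = [Z, φ X] - φ [Z, X]`. -/
def lieDerivEndo (Z : Π x : M, TangentSpace 𝓘(ℝ, E) x)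
    (φ : Π x : M, TangentSpace 𝓘(ℝ, E) x →L[ℝ] TangentSpace 𝓘(ℝ, E) x)
    (X : Π x : M, TangentSpace 𝓘(ℝ, E) x) (x : M) : TangentSpace 𝓘(ℝ, E) x :=
  VectorField.mlieBracket 𝓘(ℝ, E) Z (fun y ↦ φ y (X y)) x
    - φ x (VectorField.mlieBracket 𝓘(ℝ, E) Z X x)

/-- `L_Z φ = 0`. -/
def LieDerivEndoVanishes [IsManifold 𝓘(ℝ, E) ∞ M] (Z : Π x : M, TangentSpace 𝓘(ℝ, E) x)
    (φ : Π x : M, TangentSpace 𝓘(ℝ, E) x →L[ℝ] TangentSpace 𝓘(ℝ, E) x) : Prop :=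
  ∀ X : Π x : M, TangentSpace 𝓘(ℝ, E) x, SmoothVectorField X →
    ∀ x : M, lieDerivEndo Z φ X x = 0

/-! ### Contact pairs -/

/-- `(α₁, α₂)` is a contact pair of type `(h, k)` on the `(2h+2k+2)`-dimensional manifold `M`:
`α₁ ∧ (dα₁)^h ∧ α₂ ∧ (dα₂)^k` is a volume form (a nowhere vanishing form of top degree),
`(dα₁)^(h+1) = 0` and `(dα₂)^(k+1) = 0`. -/
structure IsContactPair [IsManifold 𝓘(ℝ, E) ∞ M] (h k : ℕ)
    (α₁ α₂ : Π x : M, TangentSpace 𝓘(ℝ, E) x →L[ℝ] ℝ) : Prop where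
  dim_eq : Module.finrank ℝ E = 2 * h + 2 * k + 2
  smooth₁ : SmoothOneForm α₁
  smooth₂ : SmoothOneForm α₂
  volume_ne_zero : ∀ x : M,
    wedge (wedge (oneForm (α₁ x).toLinearMap) (wedgePow (dOneForm α₁ x) h))
      (wedge (oneForm (α₂ x).toLinearMap) (wedgePow (dOneForm α₂ x) k)) ≠ 0
  pow₁ : ∀ x : M, wedgePow (dOneForm α₁ x) (h + 1) = 0
  pow₂ : ∀ x : M, wedgePow (dOneForm α₂ x) (k + 1) = 0

/-- `Z₁`, `Z₂` are the Reeb vector fields of `(α₁, α₂)`, that is, the vector fields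
satisfying the equations that determine them uniquely when `(α₁, α₂)` is a contact pair. -/
structure AreReebFields [IsManifold 𝓘(ℝ, E) ∞ M]
    (α₁ α₂ : Π x : M, TangentSpace 𝓘(ℝ, E) x →L[ℝ] ℝ)
    (Z₁ Z₂ : Π x : M, TangentSpace 𝓘(ℝ, E) x) : Prop where
  smooth₁ : SmoothVectorField Z₁
  smooth₂ : SmoothVectorField Z₂
  apply₁₁ : ∀ x : M, α₁ x (Z₁ x) = 1
  apply₂₂ : ∀ x : M, α₂ x (Z₂ x) = 1
  apply₁₂ : ∀ x : M, α₁ x (Z₂ x) = 0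
  apply₂₁ : ∀ x : M, α₂ x (Z₁ x) = 0
  contract₁₁ : ∀ x : M, contract (Z₁ x) (dOneForm α₁ x) = 0
  contract₁₂ : ∀ x : M, contract (Z₁ x) (dOneForm α₂ x) = 0
  contract₂₁ : ∀ x : M, contract (Z₂ x) (dOneForm α₁ x) = 0
  contract₂₂ : ∀ x : M, contract (Z₂ x) (dOneForm α₂ x) = 0

/-- `(α₁, α₂, φ)` is a contact pair structure of type `(h, k)` with Reeb vector fields
`Z₁`, `Z₂`: `φ² = -Id + α₁ ⊗ Z₁ + α₂ ⊗ Z₂` and `φ Z₁ = φ Z₂ = 0`. -/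
structure IsContactPairStructure [IsManifold 𝓘(ℝ, E) ∞ M] (h k : ℕ)
    (α₁ α₂ : Π x : M, TangentSpace 𝓘(ℝ, E) x →L[ℝ] ℝ)
    (φ : Π x : M, TangentSpace 𝓘(ℝ, E) x →L[ℝ] TangentSpace 𝓘(ℝ, E) x)
    (Z₁ Z₂ : Π x : M, TangentSpace 𝓘(ℝ, E) x) : Prop where
  isContactPair : IsContactPair h k α₁ α₂
  areReebFields : AreReebFields α₁ α₂ Z₁ Z₂
  smooth : SmoothEndo φ
  sq : ∀ (x : M) (v : TangentSpace 𝓘(ℝ, E) x),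
    φ x (φ x v) = -v + α₁ x v • Z₁ x + α₂ x v • Z₂ x
  apply₁ : ∀ x : M, φ x (Z₁ x) = 0
  apply₂ : ∀ x : M, φ x (Z₂ x) = 0

/-- The tangent space at `x` of the characteristic foliation of `α`: `Ker α ∩ Ker dα`. -/
def charDistribution (α : Π x : M, TangentSpace 𝓘(ℝ, E) x →L[ℝ] ℝ) (x : M) :
    Submodule ℝ (TangentSpace 𝓘(ℝ, E) x) :=
  LinearMap.ker (α x).toLinearMap ⊓ LinearMap.ker (dOneForm α x).curryLeft

/-- `φ` is decomposable: it preserves the tangent spaces of both characteristic foliations. -/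
def IsDecomposable (α₁ α₂ : Π x : M, TangentSpace 𝓘(ℝ, E) x →L[ℝ] ℝ)
    (φ : Π x : M, TangentSpace 𝓘(ℝ, E) x →L[ℝ] TangentSpace 𝓘(ℝ, E) x) : Prop :=
  ∀ x : M, (∀ v ∈ charDistribution α₁ x, φ x v ∈ charDistribution α₁ x) ∧
    (∀ v ∈ charDistribution α₂ x, φ x v ∈ charDistribution α₂ x)

/-- The almost complex structure `φ - α₂ ⊗ Z₁ + α₁ ⊗ Z₂` associated to `(α₁, α₂, φ)`, where
`Z₁`, `Z₂` are the Reeb vector fields. -/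
def associatedJ (α₁ α₂ : Π x : M, TangentSpace 𝓘(ℝ, E) x →L[ℝ] ℝ)
    (φ : Π x : M, TangentSpace 𝓘(ℝ, E) x →L[ℝ] TangentSpace 𝓘(ℝ, E) x)
    (Z₁ Z₂ : Π x : M, TangentSpace 𝓘(ℝ, E) x) (x : M) :
    TangentSpace 𝓘(ℝ, E) x →L[ℝ] TangentSpace 𝓘(ℝ, E) x :=
  φ x - (α₂ x).smulRight (Z₁ x) + (α₁ x).smulRight (Z₂ x)

end Manifold

end

/-! ### Linear algebra of alternating forms -/

section LinearAlgebra

variable {V : Type*} [AddCommGroup V] [Module ℝ V]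

/-! Call a field horizontal if both forms vanish on it. The forms take constant values on the Reeb
fields and on horizontal fields, so `dα_i` there is `-α_i` of the bracket
(`dOneForm_bilin_of_const`); hence brackets of Reeb fields with horizontal fields are horizontal.
For horizontal `X` this gives `N_J(Z₁, X) = (L_{Z₂}φ)X - φ(L_{Z₁}φ)X` and `N_J(Z₂, X) = -(L_{Z₁}φ)X
- φ(L_{Z₂}φ)X`. Integrability of `J` therefore makes the two Lie derivatives determine each other on
horizontal fields, which suffice because `[Z₁, Z₂] = 0`. Exchanging the indices turns `J` into `T`:
if `T` is integrable too, then `L_{Z₂}φ = φ ∘ L_{Z₁}φ = -L_{Z₂}φ` there, so both vanish.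

Conversely, if the Lie derivatives vanish, so does `N_T` as soon as one argument is a Reeb field. On
horizontal fields `N_T - N_J` is a combination of `Z₁`, `Z₂` whose coefficients are multiples of
`dα_i(φX, Y) + dα_i(X, φY)` (`nijenhuis_sub`). The Reeb components of `N_J = 0` give `dα₁(u, v) -
dα₁(φu, φv) = dα₂(φu, v) + dα₂(u, φv)` and its twin. For `u` in the characteristic space of `α₁`,
decomposability kills the left side; for `u` in that of `α₂`, it kills the right side. These spaces
span the tangent space (`char_sup_char_eq_top`), so the coefficients vanish (`bilin_add_eq_zero`).

The spanning is linear algebra: the volume form forces a trivial intersection, and `η ^ (n + 1) = 0`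
bounds the rank of `η` by `2n`, since a larger rank would yield `n + 1` orthogonal symplectic pairs,
on which the power is nonzero. -/

/-- The multilinear map `v ↦ η(v₀, v₁) η(v₂, v₃) ⋯`, whose alternatization is a multiple of the
wedge power of `η`. -/
noncomputable def pairProd (η : V [⋀^Fin 2]→ₗ[ℝ] ℝ) :
    (n : ℕ) → MultilinearMap ℝ (fun _ : Fin (2 * n) ↦ V) ℝ
  | 0 => MultilinearMap.constOfIsEmpty ℝ (fun _ : Fin 0 ↦ V) 1
  | n + 1 => ((LinearMap.mul' ℝ ℝ).compMultilinearMap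
      ((pairProd η n).domCoprod (η : MultilinearMap ℝ (fun _ : Fin 2 ↦ V) ℝ))).domDomCongr
        finSumFinEquiv

theorem pairProd_apply (η : V [⋀^Fin 2]→ₗ[ℝ] ℝ) (n : ℕ) (v : Fin (2 * n) → V) :
    pairProd η n v = ∏ i : Fin n, η ![v ⟨2 * i, by omega⟩, v ⟨2 * i + 1, by omega⟩] := by
  induction n with
  | zero => simp [pairProd]
  | succ n ih =>
    rw [Fin.prod_univ_castSucc]
    simp only [pairProd, MultilinearMap.domDomCongr_apply, LinearMap.compMultilinearMap_apply,
      MultilinearMap.domCoprod_apply, LinearMap.mul'_apply, ih]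
    congr 1
    change η _ = η _
    congr 1
    ext i
    fin_cases i <;> rfl

/-- Alternatization commutes with `domCoprod`, and each factor `η`, being already alternating on two
arguments, contributes `2! = 2`. -/
theorem alternatization_pairProd (η : V [⋀^Fin 2]→ₗ[ℝ] ℝ) (n : ℕ) :
    MultilinearMap.alternatization (pairProd η n) = (2 ^ n : ℝ) • wedgePow η n := by
  induction n with
  | zero =>
    ext v
    simp [pairProd, wedgePow, MultilinearMap.alternatization_apply]
  | succ n ih =>
    have key : ∀ (m : MultilinearMap ℝ (fun _ : Fin (2 * n) ⊕ Fin 2 ↦ V) (TensorProduct ℝ ℝ ℝ)),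
        MultilinearMap.alternatization (((LinearMap.mul' ℝ ℝ).compMultilinearMap m).domDomCongr
          (finSumFinEquiv : Fin (2 * n) ⊕ Fin 2 ≃ Fin (2 * n + 2))) =
        ((LinearMap.mul' ℝ ℝ).compAlternatingMap
          (MultilinearMap.alternatization m)).domDomCongr finSumFinEquiv := by
      intro m
      ext v
      simp only [MultilinearMap.alternatization_apply, AlternatingMap.domDomCongr_apply,
        LinearMap.compAlternatingMap_apply, map_sum]
      refine Fintype.sum_equiv (finSumFinEquiv.symm.permCongr) _ _ fun σ ↦ ?_
      simp only [Equiv.Perm.sign_permCongr, MultilinearMap.domDomCongr_apply,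
        LinearMap.compMultilinearMap_apply]
      rw [Units.smul_def, Units.smul_def, map_zsmul]
      simp [Equiv.permCongr_apply]
    have h2 : MultilinearMap.alternatization (η : MultilinearMap ℝ (fun _ : Fin 2 ↦ V) ℝ)
        = (2 : ℝ) • η := by
      rw [AlternatingMap.coe_alternatization]
      ext v
      simp
    change MultilinearMap.alternatization (((LinearMap.mul' ℝ ℝ).compMultilinearMap
      ((pairProd η n).domCoprod (η : MultilinearMap ℝ (fun _ : Fin 2 ↦ V) ℝ))).domDomCongr
        finSumFinEquiv) = (2 ^ (n + 1) : ℝ) • wedge (wedgePow η n) η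
    rw [key, MultilinearMap.domCoprod_alternization, ih, h2, ← AlternatingMap.domCoprod'_apply,
      TensorProduct.smul_tmul_smul, map_smul]
    ext v
    simp [wedge, pow_succ]

/-! ### Symplectic families and the rank of a 2-form -/

/-- Families `e₁, f₁, …, eₙ, fₙ` on which `η` takes the standard symplectic values. -/
structure IsSymplecticFamily (η : V [⋀^Fin 2]→ₗ[ℝ] ℝ) {n : ℕ} (v : Fin n × Fin 2 → V) : Prop where
  pair : ∀ i, η ![v (i, 0), v (i, 1)] = 1
  orth : ∀ p q, p.1 ≠ q.1 → η ![v p, v q] = 0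

theorem AlternatingMap.apply_swap_two (η : V [⋀^Fin 2]→ₗ[ℝ] ℝ) (x y : V) :
    η ![y, x] = - η ![x, y] := by
  have := η.map_swap ![x, y] (i := 0) (j := 1) (by decide)
  rw [← this]
  congr 1
  ext i
  fin_cases i <;> simp

/-- Nonvanishing factors force `τ` to map pairs to pairs. Then `τ` permutes the pairs, with sign
`(sign π) ^ 2 = 1` because two copies of `π` act, after flips inside the pairs; the sign of each
flip cancels the sign of the corresponding value of `η`. -/
theorem IsSymplecticFamily.sign_mul_prod_eq_one {η : V [⋀^Fin 2]→ₗ[ℝ] ℝ} {n : ℕ}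
    {v : Fin n × Fin 2 → V} (hv : IsSymplecticFamily η v) (τ : Equiv.Perm (Fin n × Fin 2))
    (hτ : ∀ i, η ![v (τ (i, 0)), v (τ (i, 1))] ≠ 0) :
    (Equiv.Perm.sign τ : ℝ) * ∏ i, η ![v (τ (i, 0)), v (τ (i, 1))] = 1 := by
  have h1 : ∀ i, (τ (i, 1)).1 = (τ (i, 0)).1 := fun i ↦ by
    by_contra h
    exact hτ i (hv.orth _ _ (Ne.symm h))
  have h2 : ∀ i j, (τ (i, j)).1 = (τ (i, 0)).1 := fun i j ↦ by
    fin_cases j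
    · rfl
    · exact h1 i
  have hsurj : Function.Surjective fun i ↦ (τ (i, 0)).1 := fun i₀ ↦ by
    obtain ⟨⟨i, j⟩, hij⟩ := τ.surjective (i₀, 0)
    exact ⟨i, by simp only [← h2 i j, hij]⟩
  have hinj (i) : Function.Injective fun j ↦ (τ (i, j)).2 := fun j j' h ↦ by
    have := τ.injective (Prod.ext ((h2 i j).trans (h2 i j').symm) h)
    simpa using this
  let π : Equiv.Perm (Fin n) := Equiv.ofBijective _
    (Finite.injective_iff_surjective.2 hsurj).bijective_of_finite
  let s (i) : Equiv.Perm (Fin 2) := Equiv.ofBijective _ (hinj i).bijective_of_finite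
  have hτs : τ = Equiv.prodCongrLeft (fun _ : Fin 2 ↦ π) * Equiv.prodCongrRight s := by
    ext1 ⟨i, j⟩
    exact Prod.ext (h2 i j) rfl
  have hsign : Equiv.Perm.sign τ = ∏ i, Equiv.Perm.sign (s i) := by
    rw [hτs, Equiv.Perm.sign_mul, Equiv.Perm.sign_prodCongrLeft, Equiv.Perm.sign_prodCongrRight]
    simp
  have hfac (i) : η ![v (τ (i, 0)), v (τ (i, 1))] = (Equiv.Perm.sign (s i) : ℝ) := by
    have e (j) : τ (i, j) = (π i, s i j) := by rw [hτs]; rfl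
    rw [e, e]
    have : ∀ t : Equiv.Perm (Fin 2), t = 1 ∨ t = Equiv.swap 0 1 := by decide
    rcases this (s i) with h | h
    · simp [h, hv.pair]
    · simp [h, AlternatingMap.apply_swap_two η (v (π i, 0)), hv.pair]
  rw [hsign, Finset.prod_congr rfl fun i _ ↦ hfac i, Units.coe_prod, Int.cast_prod,
    ← Finset.prod_mul_distrib]
  refine Finset.prod_eq_one fun i _ ↦ ?_
  rcases Int.units_eq_one_or (Equiv.Perm.sign (s i)) with h | h <;> simp [h]

/-- Evaluated on the family, every summand of the alternatized product is `0` or `1`, and the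
identity permutation gives `1`, so nothing can cancel. -/
theorem IsSymplecticFamily.wedgePow_ne_zero {η : V [⋀^Fin 2]→ₗ[ℝ] ℝ} {n : ℕ}
    {v : Fin n × Fin 2 → V} (hv : IsSymplecticFamily η v) : wedgePow η n ≠ 0 := by
  intro h0
  let e : Fin n × Fin 2 ≃ Fin (2 * n) := finProdFinEquiv.trans (finCongr (mul_comm n 2))
  have hsum : MultilinearMap.alternatization (pairProd η n) (v ∘ e.symm) = 0 := by
    rw [alternatization_pairProd, h0]; simp
  rw [MultilinearMap.alternatization_apply] at hsum
  have hterm (σ : Equiv.Perm (Fin (2 * n))) :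
      (Equiv.Perm.sign σ • (pairProd η n).domDomCongr σ (v ∘ e.symm) : ℝ) =
      (Equiv.Perm.sign (e.symm.permCongr σ) : ℝ) *
        ∏ i, η ![v (e.symm.permCongr σ (i, 0)), v (e.symm.permCongr σ (i, 1))] := by
    have e0 (i : Fin n) : e (i, 0) = ⟨2 * i, by omega⟩ := by ext; simp [e]
    have e1 (i : Fin n) : e (i, 1) = ⟨2 * i + 1, by omega⟩ := by ext; simp [e]; omega
    rw [Equiv.Perm.sign_permCongr, Units.smul_def, zsmul_eq_mul, MultilinearMap.domDomCongr_apply,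
      pairProd_apply]
    simp [Equiv.permCongr_apply, e0, e1]
  have hpos : ∀ σ : Equiv.Perm (Fin (2 * n)),
      0 ≤ (Equiv.Perm.sign σ • (pairProd η n).domDomCongr σ (v ∘ e.symm) : ℝ) := fun σ ↦ by
    rw [hterm]
    by_cases h : ∀ i, η ![v (e.symm.permCongr σ (i, 0)), v (e.symm.permCongr σ (i, 1))] ≠ 0
    · rw [hv.sign_mul_prod_eq_one _ h]; exact zero_le_one
    · push Not at h
      obtain ⟨i, hi⟩ := h
      rw [Finset.prod_eq_zero (Finset.mem_univ i) hi, mul_zero]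
  have h1 := (Finset.sum_eq_zero_iff_of_nonneg fun σ _ ↦ hpos σ).1 hsum 1 (Finset.mem_univ _)
  rw [hterm, hv.sign_mul_prod_eq_one] at h1
  · exact one_ne_zero h1
  · intro i
    simp [Equiv.permCongr_apply, hv.pair]

/-- A `2`-form, regarded as a bilinear form. -/
noncomputable def AlternatingMap.bilin (η : V [⋀^Fin 2]→ₗ[ℝ] ℝ) : V →ₗ[ℝ] V →ₗ[ℝ] ℝ :=
  have h (x y : V) : Function.update ![x, 0] 1 y = ![x, y] := by
    ext i; fin_cases i <;> rfl
  have h' (x y : V) : Function.update ![0, y] 0 x = ![x, y] := by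
    ext i; fin_cases i <;> rfl
  LinearMap.mk₂ ℝ (fun x y ↦ η ![x, y])
    (fun x x' y ↦ by simpa only [h'] using η.map_update_add ![0, y] 0 x x')
    (fun c x y ↦ by simpa only [h'] using η.map_update_smul ![0, y] 0 c x)
    (fun x y y' ↦ by simpa only [h] using η.map_update_add ![x, 0] 1 y y')
    (fun c x y ↦ by simpa only [h] using η.map_update_smul ![x, 0] 1 c y)

theorem AlternatingMap.bilin_apply (η : V [⋀^Fin 2]→ₗ[ℝ] ℝ) (x y : V) :
    η.bilin x y = η ![x, y] := rfl

theorem AlternatingMap.bilin_swap (η : V [⋀^Fin 2]→ₗ[ℝ] ℝ) (x y : V) :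
    η.bilin y x = - η.bilin x y := η.apply_swap_two x y

theorem AlternatingMap.bilin_self (η : V [⋀^Fin 2]→ₗ[ℝ] ℝ) (x : V) : η.bilin x x = 0 :=
  η.map_eq_zero_of_eq _ (i := 0) (j := 1) rfl (by decide)

theorem AlternatingMap.curryLeft_eq_zero_iff (η : V [⋀^Fin 2]→ₗ[ℝ] ℝ) (x : V) :
    η.curryLeft x = 0 ↔ ∀ y, η.bilin x y = 0 := by
  refine ⟨fun h y ↦ congr($h ![y]), fun h ↦ ?_⟩
  ext w
  have : ![x, w 0] = Matrix.vecCons x w := by ext i; fin_cases i <;> rfl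
  simpa [AlternatingMap.bilin_apply, this] using h (w 0)

/-- Symplectic Gram–Schmidt. The orthogonal of `m ≤ n` pairs has codimension at most `2m ≤ 2n`, less
than the rank, so it contains some `x` outside the kernel of `η`. A partner of `x` is made
orthogonal to the earlier pairs and rescaled. -/
theorem IsSymplecticFamily.exists_of_lt_finrank [FiniteDimensional ℝ V]
    (η : V [⋀^Fin 2]→ₗ[ℝ] ℝ) (n m : ℕ)
    (hη : Module.finrank ℝ (LinearMap.ker η.curryLeft) + 2 * n < Module.finrank ℝ V)
    (hm : m ≤ n + 1) : ∃ v : Fin m × Fin 2 → V, IsSymplecticFamily η v := by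
  induction m with
  | zero => exact ⟨fun p ↦ p.1.elim0, fun i ↦ i.elim0, fun p ↦ p.1.elim0⟩
  | succ m ih =>
    obtain ⟨v, hv⟩ := ih (by omega)
    let B : V →ₗ[ℝ] (Fin m × Fin 2 → ℝ) := LinearMap.pi fun p ↦ η.bilin (v p)
    have hdim : Module.finrank ℝ V ≤ Module.finrank ℝ (LinearMap.ker B) + 2 * m := by
      have h1 := B.finrank_range_add_finrank_ker
      have h2 := (LinearMap.range B).finrank_le
      rw [Module.finrank_fintype_fun_eq_card, Fintype.card_prod, Fintype.card_fin,
        Fintype.card_fin] at h2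
      omega
    obtain ⟨x, hx, hx'⟩ : ∃ x ∈ LinearMap.ker B, x ∉ LinearMap.ker η.curryLeft := by
      by_contra! h
      have := Submodule.finrank_mono (show LinearMap.ker B ≤ LinearMap.ker η.curryLeft from h)
      omega
    obtain ⟨y, hy⟩ : ∃ y, η.bilin x y ≠ 0 := by
      by_contra! h
      exact hx' (LinearMap.mem_ker.2 ((η.curryLeft_eq_zero_iff x).2 h))
    have hxv (p) : η.bilin (v p) x = 0 := congrFun (LinearMap.mem_ker.1 hx) p
    have hxv' (p) : η.bilin x (v p) = 0 := by rw [η.bilin_swap (v p) x, hxv, neg_zero]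
    -- projecting `y` to the orthogonal of the family
    obtain ⟨y', hxy', hvy'⟩ : ∃ y', η.bilin x y' ≠ 0 ∧ ∀ p, η.bilin (v p) y' = 0 := by
      refine ⟨y + ∑ i : Fin m,
        ((-η.bilin (v (i, 0)) y) • v (i, 1) + η.bilin (v (i, 1)) y • v (i, 0)), ?_, ?_⟩
      · simpa [hxv'] using hy
      · rintro ⟨i, j⟩
        have h (i' j') (hi : i' ≠ i) : η.bilin (v (i, j)) (v (i', j')) = 0 :=
          hv.orth _ _ (Ne.symm hi)
        rw [map_add, map_sum, Finset.sum_eq_single i]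
        · have h01 : η.bilin (v (i, 0)) (v (i, 1)) = 1 := hv.pair i
          fin_cases j
          · simp [h01, η.bilin_self]
          · simp [η.bilin_swap (v (i, 0)) (v (i, 1)), h01, η.bilin_self]
        · intro i' _ hi
          simp [h _ _ hi]
        · simp
    let w : Fin (m + 1) → Fin 2 → V :=
      Fin.snoc (fun i j ↦ v (i, j)) ![x, (η.bilin x y')⁻¹ • y']
    have hlast (i : Fin m) (j j' : Fin 2) :
        η.bilin (v (i, j)) ((![x, (η.bilin x y')⁻¹ • y'] : Fin 2 → V) j') = 0 := by
      fin_cases j' <;> simp [hxv, hvy']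
    refine ⟨fun p ↦ w p.1 p.2, fun i ↦ ?_, fun p q hpq ↦ ?_⟩
    · induction i using Fin.lastCases with
      | last =>
        rw [← η.bilin_apply]
        simp [w, hxy']
      | cast i => simpa [w] using hv.pair i
    · obtain ⟨i, j⟩ := p
      obtain ⟨i', j'⟩ := q
      rw [← η.bilin_apply]
      induction i using Fin.lastCases with
      | last =>
        induction i' using Fin.lastCases with
        | last => exact absurd rfl hpq
        | cast i' =>
          rw [η.bilin_swap, neg_eq_zero]
          simpa [w] using hlast i' j' j
      | cast i =>
        induction i' using Fin.lastCases with
        | last => simpa [w] using hlast i j j'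
        | cast i' =>
          simpa [w, η.bilin_apply] using hv.orth (i, j) (i', j') (by simpa using hpq)

/-- A `2`-form with `η ^ (n + 1) = 0` has rank at most `2 n`. -/
theorem finrank_le_finrank_ker_add_of_wedgePow_eq_zero [FiniteDimensional ℝ V]
    {η : V [⋀^Fin 2]→ₗ[ℝ] ℝ} {n : ℕ} (h : wedgePow η (n + 1) = 0) :
    Module.finrank ℝ V ≤ Module.finrank ℝ (LinearMap.ker η.curryLeft) + 2 * n := by
  by_contra! hlt
  obtain ⟨v, hv⟩ := IsSymplecticFamily.exists_of_lt_finrank η n (n + 1) hlt le_rfl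
  exact hv.wedgePow_ne_zero h

/-! ### Vectors annihilating a form -/

/-- The contraction of the alternating form `a` with `v` vanishes. -/
def Annihilates (v : V) {p : ℕ} (a : V [⋀^Fin p]→ₗ[ℝ] ℝ) : Prop :=
  ∀ w : Fin p → V, (∃ i, w i = v) → a w = 0

/-- In each shuffle term the argument `v` is fed to one of the two factors. -/
theorem Annihilates.wedge {v : V} {p q : ℕ} {a : V [⋀^Fin p]→ₗ[ℝ] ℝ} {b : V [⋀^Fin q]→ₗ[ℝ] ℝ}
    (ha : Annihilates v a) (hb : Annihilates v b) : Annihilates v (wedge a b) := by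
  rintro w ⟨i, hi⟩
  simp only [_root_.wedge, AlternatingMap.domDomCongr_apply, LinearMap.compAlternatingMap_apply,
    AlternatingMap.domCoprod_apply, sum_apply, map_sum]
  refine Finset.sum_eq_zero fun σ _ ↦ ?_
  induction σ using Quotient.inductionOn' with | _ σ
  have : a (fun j ↦ w (finSumFinEquiv (σ (Sum.inl j)))) = 0 ∨
      b (fun j ↦ w (finSumFinEquiv (σ (Sum.inr j)))) = 0 := by
    rcases h : σ.symm (finSumFinEquiv.symm i) with j | j
    · left
      exact ha _ ⟨j, by simp [← h, hi]⟩
    · right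
      exact hb _ ⟨j, by simp [← h, hi]⟩
  rw [AlternatingMap.domCoprod.summand_mk'', smul_apply, Units.smul_def, map_zsmul,
    MultilinearMap.domDomCongr_apply, MultilinearMap.domCoprod_apply, LinearMap.mul'_apply]
  rcases this with h | h <;> simp [h]

theorem Annihilates.wedgePow {v : V} {η : V [⋀^Fin 2]→ₗ[ℝ] ℝ} (hη : Annihilates v η) (n : ℕ) :
    Annihilates v (wedgePow η n) := by
  induction n with
  | zero => rintro w ⟨i, _⟩; exact i.elim0
  | succ n ih => exact ih.wedge hη

theorem annihilates_oneForm {v : V} {a : V →ₗ[ℝ] ℝ} (h : a v = 0) : Annihilates v (oneForm a) := by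
  rintro w ⟨i, rfl⟩
  obtain rfl := Subsingleton.elim i 0
  simpa [oneForm] using h

theorem annihilates_twoForm {v : V} {η : V [⋀^Fin 2]→ₗ[ℝ] ℝ} (h : η.curryLeft v = 0) :
    Annihilates v η := by
  rw [AlternatingMap.curryLeft_eq_zero_iff] at h
  rintro w ⟨i, rfl⟩
  have hw : w = ![w 0, w 1] := by ext i; fin_cases i <;> rfl
  rw [hw, ← η.bilin_apply]
  fin_cases i
  · exact h _
  · rw [η.bilin_swap, neg_eq_zero]
    exact h _

/-- No nonzero vector annihilates a nonzero form of top degree. -/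
theorem Annihilates.eq_zero_of_ne_zero [FiniteDimensional ℝ V] {v : V} {n : ℕ}
    {Ω : V [⋀^Fin n]→ₗ[ℝ] ℝ} (hn : Module.finrank ℝ V = n) (hΩ : Ω ≠ 0) (hv : Annihilates v Ω) :
    v = 0 := by
  by_contra h0
  have hli : LinearIndepOn ℝ id ({v} : Set V) := by simpa [LinearIndepOn] using h0
  let b := Module.Basis.extend hli
  have hvm : v ∈ hli.extend (Set.subset_univ _) := hli.subset_extend _ rfl
  have : Fintype (hli.extend (Set.subset_univ ({v} : Set V))) :=
    FiniteDimensional.fintypeBasisIndex b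
  have hcard : Fintype.card (hli.extend (Set.subset_univ ({v} : Set V))) = n := by
    rw [← Module.finrank_eq_card_basis b, hn]
  let b' := b.reindex (Fintype.equivFinOfCardEq hcard)
  apply hΩ
  -- A top-degree form is determined by its value on one basis, and here `v` is a basis vector.
  rw [AlternatingMap.eq_smul_basis_det b' Ω,
    hv b' ⟨Fintype.equivFinOfCardEq hcard ⟨v, hvm⟩, by simp [b', b]⟩, zero_smul]

/-- The forms of a linear contact pair have no common nonzero kernel vector. -/
theorem eq_zero_of_wedge_ne_zero [FiniteDimensional ℝ V] {h k : ℕ} {a₁ a₂ : V →ₗ[ℝ] ℝ}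
    {η₁ η₂ : V [⋀^Fin 2]→ₗ[ℝ] ℝ} (hdim : Module.finrank ℝ V = 2 * h + 2 * k + 2)
    (hΩ : wedge (wedge (oneForm a₁) (wedgePow η₁ h)) (wedge (oneForm a₂) (wedgePow η₂ k)) ≠ 0)
    {v : V} (ha₁ : a₁ v = 0) (ha₂ : a₂ v = 0) (hη₁ : η₁.curryLeft v = 0)
    (hη₂ : η₂.curryLeft v = 0) : v = 0 :=
  Annihilates.eq_zero_of_ne_zero (by omega) hΩ
    (((annihilates_oneForm ha₁).wedge ((annihilates_twoForm hη₁).wedgePow h)).wedge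
      ((annihilates_oneForm ha₂).wedge ((annihilates_twoForm hη₂).wedgePow k)))

theorem finrank_le_finrank_inf_ker [FiniteDimensional ℝ V] (W : Submodule ℝ V) (a : V →ₗ[ℝ] ℝ) :
    Module.finrank ℝ W ≤ Module.finrank ℝ (LinearMap.ker a ⊓ W : Submodule ℝ V) + 1 := by
  have h1 := (a.comp W.subtype).finrank_range_add_finrank_ker
  have h2 := (LinearMap.range (a.comp W.subtype)).finrank_le
  rw [Module.finrank_self] at h2
  rw [LinearMap.ker_comp, ← Submodule.finrank_map_subtype_eq, Submodule.map_comap_subtype] at h1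
  rw [inf_comm]
  omega

/-! ### Characteristic spaces of a linear contact pair -/

/-- The characteristic spaces of a linear contact pair are complementary. -/
theorem char_sup_char_eq_top [FiniteDimensional ℝ V] {h k : ℕ} {a₁ a₂ : V →ₗ[ℝ] ℝ}
    {η₁ η₂ : V [⋀^Fin 2]→ₗ[ℝ] ℝ} (hdim : Module.finrank ℝ V = 2 * h + 2 * k + 2)
    (hΩ : wedge (wedge (oneForm a₁) (wedgePow η₁ h)) (wedge (oneForm a₂) (wedgePow η₂ k)) ≠ 0)
    (hη₁ : wedgePow η₁ (h + 1) = 0) (hη₂ : wedgePow η₂ (k + 1) = 0) :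
    (LinearMap.ker a₁ ⊓ LinearMap.ker η₁.curryLeft) ⊔
      (LinearMap.ker a₂ ⊓ LinearMap.ker η₂.curryLeft) = ⊤ := by
  have hinf : (LinearMap.ker a₁ ⊓ LinearMap.ker η₁.curryLeft) ⊓
      (LinearMap.ker a₂ ⊓ LinearMap.ker η₂.curryLeft) = ⊥ := by
    rw [eq_bot_iff]
    rintro v ⟨⟨h1, h2⟩, h3, h4⟩
    exact eq_zero_of_wedge_ne_zero hdim hΩ h1 h3 h2 h4
  apply Submodule.eq_top_of_finrank_eq
  have h0 := Submodule.finrank_sup_add_finrank_inf_eq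
    (LinearMap.ker a₁ ⊓ LinearMap.ker η₁.curryLeft) (LinearMap.ker a₂ ⊓ LinearMap.ker η₂.curryLeft)
  rw [hinf, finrank_bot] at h0
  -- The rank bounds give dimensions at least `2k + 1` and `2h + 1`, which already add up to `dim
  -- V`.
  have h1 := finrank_le_finrank_inf_ker (LinearMap.ker η₁.curryLeft) a₁
  have h2 := finrank_le_finrank_inf_ker (LinearMap.ker η₂.curryLeft) a₂
  have h3 := finrank_le_finrank_ker_add_of_wedgePow_eq_zero hη₁
  have h4 := finrank_le_finrank_ker_add_of_wedgePow_eq_zero hη₂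
  have h5 := Submodule.finrank_le ((LinearMap.ker a₁ ⊓ LinearMap.ker η₁.curryLeft) ⊔
    (LinearMap.ker a₂ ⊓ LinearMap.ker η₂.curryLeft))
  omega

end LinearAlgebra

section Geometry

open Bundle VectorField Set Filter Topology

variable {E : Type*} [NormedAddCommGroup E] [NormedSpace ℝ E]
  {M : Type*} [TopologicalSpace M] [ChartedSpace E M] [IsManifold 𝓘(ℝ, E) ∞ M]

/-! ### Smooth tensor fields -/

theorem SmoothVectorField.add {X Y : Π x : M, TangentSpace 𝓘(ℝ, E) x}
    (hX : SmoothVectorField X) (hY : SmoothVectorField Y) : SmoothVectorField (X + Y) :=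
  ContMDiff.add_section hX hY

theorem SmoothVectorField.neg {X : Π x : M, TangentSpace 𝓘(ℝ, E) x}
    (hX : SmoothVectorField X) : SmoothVectorField (-X) :=
  ContMDiff.neg_section hX

theorem SmoothVectorField.smul {f : M → ℝ} {X : Π x : M, TangentSpace 𝓘(ℝ, E) x}
    (hf : ContMDiff 𝓘(ℝ, E) 𝓘(ℝ) ∞ f) (hX : SmoothVectorField X) : SmoothVectorField (f • X) :=
  ContMDiff.smul_section hf hX

theorem SmoothVectorField.mdifferentiableAt {X : Π x : M, TangentSpace 𝓘(ℝ, E) x}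
    (hX : SmoothVectorField X) (x : M) :
    MDifferentiableAt 𝓘(ℝ, E) (𝓘(ℝ, E).prod 𝓘(ℝ, E))
      (fun y ↦ TotalSpace.mk' E (E := fun x : M ↦ TangentSpace 𝓘(ℝ, E) x) y (X y)) x :=
  (hX x).mdifferentiableAt (by simp)

theorem SmoothEndo.apply {A : Π x : M, TangentSpace 𝓘(ℝ, E) x →L[ℝ] TangentSpace 𝓘(ℝ, E) x}
    {X : Π x : M, TangentSpace 𝓘(ℝ, E) x}
    (hA : SmoothEndo A) (hX : SmoothVectorField X) : SmoothVectorField fun x ↦ A x (X x) :=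
  ContMDiff.clm_bundle_apply hA hX

theorem SmoothOneForm.apply {α : Π x : M, TangentSpace 𝓘(ℝ, E) x →L[ℝ] ℝ}
    {X : Π x : M, TangentSpace 𝓘(ℝ, E) x}
    (hα : SmoothOneForm α) (hX : SmoothVectorField X) :
    ContMDiff 𝓘(ℝ, E) 𝓘(ℝ) ∞ fun x ↦ α x (X x) := by
  have := ContMDiff.clm_bundle_apply (E₂ := Bundle.Trivial M ℝ) hα hX
  intro x
  exact (Bundle.contMDiffAt_section (E := Bundle.Trivial M ℝ) (F := ℝ)
    (s := fun x ↦ α x (X x)) x).1 (this x)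

theorem SmoothVectorField.mlieBracket [CompleteSpace E] {X Y : Π x : M, TangentSpace 𝓘(ℝ, E) x}
    (hX : SmoothVectorField X) (hY : SmoothVectorField Y) :
    SmoothVectorField (mlieBracket 𝓘(ℝ, E) X Y) := by
  have : IsManifold 𝓘(ℝ, E) ((⊤ : ℕ∞) + 1) M := by simpa
  have : IsManifold 𝓘(ℝ, E) (minSmoothness ℝ 2) M := by
    simpa using inferInstanceAs (IsManifold 𝓘(ℝ, E) 2 M)
  have : IsManifold 𝓘(ℝ, E) (minSmoothness ℝ 3) M := by
    simpa using inferInstanceAs (IsManifold 𝓘(ℝ, E) 3 M)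
  exact ContDiff.mlieBracket_vectorField (m := ⊤) (n := ⊤) hX hY (by simp)

/-- A local extension is cut off by a bump function. This turns identities between fields into
pointwise ones. -/
theorem exists_smoothVectorField_apply_eq [FiniteDimensional ℝ E] [T2Space M] (x : M)
    (v : TangentSpace 𝓘(ℝ, E) x) :
    ∃ X : Π x : M, TangentSpace 𝓘(ℝ, E) x, SmoothVectorField X ∧ X x = v := by
  obtain ⟨s, hs, hsm⟩ := FiberBundle.exists_contMDiffOn_extend (k := ∞) 𝓘(ℝ, E) E
    (V := fun x : M ↦ TangentSpace 𝓘(ℝ, E) x) v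
  obtain ⟨f, -, hf⟩ := (SmoothBumpFunction.nhds_basis_tsupport
    (I := 𝓘(ℝ, E)) x).mem_iff.1 (interior_mem_nhds.2 hs)
  refine ⟨(f : M → ℝ) • FiberBundle.extend E v, ?_, ?_⟩
  · exact ContMDiffOn.smul_section_of_tsupport f.contMDiff.contMDiffOn isOpen_interior hf
      (hsm.mono interior_subset)
  · simp

theorem differentiableAt_mpullbackWithin_extChartAt_symm [CompleteSpace E]
    {X : Π x : M, TangentSpace 𝓘(ℝ, E) x} (hX : SmoothVectorField X) (x : M) :
    DifferentiableAt ℝ (mpullbackWithin 𝓘(ℝ, E) 𝓘(ℝ, E) (extChartAt 𝓘(ℝ, E) x).symm X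
      (range 𝓘(ℝ, E))) (extChartAt 𝓘(ℝ, E) x x) := by
  have h := ((hX.mdifferentiableAt x).mdifferentiableWithinAt
    (s := univ)).differentiableWithinAt_mpullbackWithin_vectorField
  exact h.differentiableAt (by simp)

/-- Near `x` the inverse of the tangent trivialization is the derivative of the inverse chart, so
the chart representation is the bundle coordinate expression of `α`. -/
theorem SmoothOneForm.differentiableAt_oneFormInChart [FiniteDimensional ℝ E]
    {α : Π x : M, TangentSpace 𝓘(ℝ, E) x →L[ℝ] ℝ} (hα : SmoothOneForm α) (x : M) :
    DifferentiableAt ℝ (oneFormInChart α x) (extChartAt 𝓘(ℝ, E) x x) := by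
  let L : (E →L[ℝ] ℝ) →L[ℝ] (E [⋀^Fin 1]→L[ℝ] ℝ) := LinearMap.toContinuousLinearMap
    { toFun := ContinuousAlternatingMap.ofSubsingleton ℝ E ℝ (0 : Fin 1)
      map_add' := fun _ _ ↦ rfl
      map_smul' := fun _ _ ↦ rfl }
  have h1 := ((contMDiffAt_hom_bundle _).1 (hα x)).2
  have h2 : ContMDiffAt 𝓘(ℝ, E) 𝓘(ℝ, E) ∞ (extChartAt 𝓘(ℝ, E) x).symm
      (extChartAt 𝓘(ℝ, E) x x) :=
    (contMDiffOn_extChartAt_symm x).contMDiffAt (extChartAt_target_mem_nhds x)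
  have h3 := ContMDiffAt.comp_of_eq h1 h2 (extChartAt_to_inv x)
  have h4 := (L.contDiff.contMDiff.contMDiffAt.comp _ h3).contDiffAt.differentiableAt (by simp)
  refine h4.congr_of_eventuallyEq ?_
  filter_upwards [extChartAt_target_mem_nhds (I := 𝓘(ℝ, E)) x] with y hy
  have hs : (extChartAt 𝓘(ℝ, E) x).symm y ∈ (chartAt E x).source := by
    simpa using (extChartAt 𝓘(ℝ, E) x).map_target hy
  refine congrArg (ContinuousAlternatingMap.ofSubsingleton ℝ E ℝ (0 : Fin 1)) ?_
  have h5 := TangentBundle.symmL_trivializationAt (I := 𝓘(ℝ, E)) hs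
  rw [(extChartAt 𝓘(ℝ, E) x).right_inv hy] at h5
  have h6 : mfderivWithin 𝓘(ℝ, E) 𝓘(ℝ, E) (extChartAt 𝓘(ℝ, E) x).symm (range 𝓘(ℝ, E)) y =
      mfderiv 𝓘(ℝ, E) 𝓘(ℝ, E) (extChartAt 𝓘(ℝ, E) x).symm y := by
    simp
    rfl
  ext v
  have h7 : (trivializationAt E (TangentSpace 𝓘(ℝ, E)) x).symmL ℝ
      ((extChartAt 𝓘(ℝ, E) x).symm y) v =
      mfderiv 𝓘(ℝ, E) 𝓘(ℝ, E) (extChartAt 𝓘(ℝ, E) x).symm y v := by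
    rw [h5, h6]
    rfl
  change α _ (mfderiv 𝓘(ℝ, E) 𝓘(ℝ, E) (extChartAt 𝓘(ℝ, E) x).symm y v) = _
  rw [← h7]
  simp [ContinuousLinearMap.inCoordinates]
  rfl

/-- The value of the exterior derivative on vector fields on which the form is constant. -/
theorem dOneForm_bilin_of_const [FiniteDimensional ℝ E]
    {α : Π x : M, TangentSpace 𝓘(ℝ, E) x →L[ℝ] ℝ} (hα : SmoothOneForm α)
    {X Y : Π x : M, TangentSpace 𝓘(ℝ, E) x} (hX : SmoothVectorField X) (hY : SmoothVectorField Y)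
    {a b : ℝ} (hXa : ∀ y, α y (X y) = a) (hYb : ∀ y, α y (Y y) = b) (x : M) :
    (dOneForm α x).bilin (X x) (Y x) = - α x (mlieBracket 𝓘(ℝ, E) X Y x) := by
  have : CompleteSpace E := FiniteDimensional.complete ℝ E
  set X' : E → E := mpullbackWithin 𝓘(ℝ, E) 𝓘(ℝ, E) (extChartAt 𝓘(ℝ, E) x).symm X
    (range 𝓘(ℝ, E))
  set Y' : E → E := mpullbackWithin 𝓘(ℝ, E) 𝓘(ℝ, E) (extChartAt 𝓘(ℝ, E) x).symm Y
    (range 𝓘(ℝ, E))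
  set y₀ : E := extChartAt 𝓘(ℝ, E) x x
  have hconst (Z : Π x : M, TangentSpace 𝓘(ℝ, E) x) (c : ℝ) (hZ : ∀ y, α y (Z y) = c)
      (w : E → Fin 1 → E) (hw : ∀ y, w y 0 = mpullbackWithin 𝓘(ℝ, E) 𝓘(ℝ, E)
        (extChartAt 𝓘(ℝ, E) x).symm Z (range 𝓘(ℝ, E)) y) :
      fderiv ℝ (fun y ↦ oneFormInChart α x y (w y)) y₀ = 0 := by
    have : (fun y ↦ oneFormInChart α x y (w y)) =ᶠ[𝓝 y₀] fun _ ↦ c := by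
      filter_upwards [extChartAt_target_mem_nhds (I := 𝓘(ℝ, E)) x] with y hy
      have hinv := isInvertible_mfderivWithin_extChartAt_symm (I := 𝓘(ℝ, E)) hy
      rw [← hZ ((extChartAt 𝓘(ℝ, E) x).symm y)]
      change α _ (mfderiv 𝓘(ℝ, E) 𝓘(ℝ, E) (extChartAt 𝓘(ℝ, E) x).symm y (w y 0)) = _
      rw [hw, mpullbackWithin_apply, ← mfderivWithin_univ, ← ModelWithCorners.range_eq_univ 𝓘(ℝ, E)]
      exact congrArg _ (hinv.self_apply_inverse _)
    rw [this.fderiv_eq]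
    simp
  -- This is `dα(X, Y) = X(αY) - Y(αX) - α[X, Y]` in the chart; the first two terms drop out because
  -- `αX` and `αY` are constant.
  have key := extDeriv_apply_vectorField (hα.differentiableAt_oneFormInChart x) (V := ![X', Y'])
    (by
      intro i
      fin_cases i
      · exact differentiableAt_mpullbackWithin_extChartAt_symm hX x
      · exact differentiableAt_mpullbackWithin_extChartAt_symm hY x)
  rw [Fin.sum_univ_two, hconst Y b hYb _ (fun y ↦ rfl), hconst X a hXa _ (fun y ↦ rfl)] at key
  -- At its own base point the preferred chart has derivative the identity of `E`, so chart objects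
  -- at `y₀` agree with the original ones at `x`.
  have hpt (Z : Π x : M, TangentSpace 𝓘(ℝ, E) x) :
      mpullbackWithin 𝓘(ℝ, E) 𝓘(ℝ, E) (extChartAt 𝓘(ℝ, E) x).symm Z (range 𝓘(ℝ, E)) y₀ = Z x := by
    have h (z : M) (hz : z = x) : (Z z : E) = Z x := by rw [hz]
    have h' := mfderivWithin_extChartAt_symm_inverse_apply (I := 𝓘(ℝ, E)) (x := x) (Z x)
    rw [mpullbackWithin_apply]
    exact (congrArg (mfderivWithin 𝓘(ℝ, E) 𝓘(ℝ, E) (extChartAt 𝓘(ℝ, E) x).symm (range 𝓘(ℝ, E))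
      (extChartAt 𝓘(ℝ, E) x x)).inverse (h _ (extChartAt_to_inv x))).trans h'
  have hbr : lieBracket ℝ X' Y' y₀ = mlieBracket 𝓘(ℝ, E) X Y x := by
    have h : lieBracketWithin ℝ X' Y' ((extChartAt 𝓘(ℝ, E) x).symm ⁻¹' univ ∩ range 𝓘(ℝ, E)) y₀ =
        lieBracket ℝ X' Y' y₀ := by
      rw [← lieBracketWithin_univ]
      simp
    rw [← h, mlieBracket, mlieBracketWithin_apply, mfderiv_extChartAt_self]
    exact (congrArg (fun L : E →L[ℝ] E ↦ L _) ContinuousLinearMap.inverse_id).symm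
  have hone (v : E) (w : Fin 1 → E) (hw : w 0 = v) : oneFormInChart α x y₀ w = α x v := by
    have h (z : M) (hz : z = x) (u : E) : α z u = α x u := by rw [hz]
    change α _ (mfderiv 𝓘(ℝ, E) 𝓘(ℝ, E) (extChartAt 𝓘(ℝ, E) x).symm y₀ (w 0)) = _
    rw [hw]
    refine (h _ (extChartAt_to_inv x) _).trans (congrArg (α x) ?_)
    have := mfderivWithin_range_extChartAt_symm (I := 𝓘(ℝ, E)) (x := x)
    rw [ModelWithCorners.range_eq_univ, mfderivWithin_univ] at this
    exact congrArg (fun L : E →L[ℝ] E ↦ L v) this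
  have hlhs : (dOneForm α x).bilin (X x) (Y x) =
      extDeriv (oneFormInChart α x) y₀ (fun i ↦ (![X', Y'] : Fin 2 → E → E) i y₀) := by
    change extDeriv (oneFormInChart α x) y₀
      (fun i ↦ mfderiv 𝓘(ℝ, E) 𝓘(ℝ, E) (extChartAt 𝓘(ℝ, E) x) x
        ((![X x, Y x] : Fin 2 → TangentSpace 𝓘(ℝ, E) x) i)) = _
    congr 1
    ext i
    rw [mfderiv_extChartAt_self]
    fin_cases i
    · exact (hpt X).symm
    · exact (hpt Y).symm
  rw [hlhs, key]
  have hsum : ∀ f : Fin 1 → Fin 1 → ℝ, ∑ i, ∑ j ≥ i, f i j = f 0 0 := by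
    intro f
    simp
  rw [hsum]
  simp only [Fin.val_zero, add_zero, pow_zero, one_smul]
  rw [hone (mlieBracket 𝓘(ℝ, E) X Y x) _ hbr]
  simp

theorem SmoothOneForm.apply_mlieBracket_eq_zero [FiniteDimensional ℝ E]
    {α : Π x : M, TangentSpace 𝓘(ℝ, E) x →L[ℝ] ℝ} (hα : SmoothOneForm α)
    {Z Y : Π x : M, TangentSpace 𝓘(ℝ, E) x} (hZ : SmoothVectorField Z) (hY : SmoothVectorField Y)
    {a b : ℝ} (hZa : ∀ y, α y (Z y) = a) (hYb : ∀ y, α y (Y y) = b)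
    (hc : ∀ y, contract (Z y) (dOneForm α y) = 0) (x : M) :
    α x (mlieBracket 𝓘(ℝ, E) Z Y x) = 0 := by
  have h := dOneForm_bilin_of_const hα hZ hY hZa hYb x
  rw [((dOneForm α x).curryLeft_eq_zero_iff (Z x)).1 (hc x)] at h
  linarith

/-! ### The Nijenhuis tensor -/

omit [IsManifold 𝓘(ℝ, E) ∞ M] in
theorem nijenhuis_swap (A : Π x : M, TangentSpace 𝓘(ℝ, E) x →L[ℝ] TangentSpace 𝓘(ℝ, E) x)
    (X Y : Π x : M, TangentSpace 𝓘(ℝ, E) x) (x : M) :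
    nijenhuis A Y X x = - nijenhuis A X Y x := by
  simp only [nijenhuis]
  rw [mlieBracket_swap_apply (V := Y) (W := X),
    mlieBracket_swap_apply (V := fun y ↦ A y (Y y)) (W := fun y ↦ A y (X y)),
    mlieBracket_swap_apply (V := fun y ↦ A y (Y y)) (W := X),
    mlieBracket_swap_apply (V := Y) (W := fun y ↦ A y (X y))]
  simp only [map_neg]
  module

variable {A : Π x : M, TangentSpace 𝓘(ℝ, E) x →L[ℝ] TangentSpace 𝓘(ℝ, E) x}

theorem nijenhuis_add_left [CompleteSpace E]
    (hA : ∀ X, SmoothVectorField X → SmoothVectorField fun y ↦ A y (X y))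
    {X X' Y : Π x : M, TangentSpace 𝓘(ℝ, E) x} (hX : SmoothVectorField X)
    (hX' : SmoothVectorField X') (x : M) :
    nijenhuis A (X + X') Y x = nijenhuis A X Y x + nijenhuis A X' Y x := by
  have h : (fun y ↦ A y ((X + X') y)) = (fun y ↦ A y (X y)) + fun y ↦ A y (X' y) := by
    ext y; simp
  simp only [nijenhuis, h]
  rw [mlieBracket_add_left (hX.mdifferentiableAt x) (hX'.mdifferentiableAt x),
    mlieBracket_add_left (hX.mdifferentiableAt x) (hX'.mdifferentiableAt x),
    mlieBracket_add_left ((hA X hX).mdifferentiableAt x) ((hA X' hX').mdifferentiableAt x),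
    mlieBracket_add_left ((hA X hX).mdifferentiableAt x) ((hA X' hX').mdifferentiableAt x)]
  simp only [map_add]
  module

/-- The derivatives of `f` along `Y` and along `AY` each occur twice with opposite signs; no
condition on `A²` enters. -/
theorem nijenhuis_smul_left [CompleteSpace E]
    (hA : ∀ X, SmoothVectorField X → SmoothVectorField fun y ↦ A y (X y))
    {f : M → ℝ} {X Y : Π x : M, TangentSpace 𝓘(ℝ, E) x}
    (hf : ContMDiff 𝓘(ℝ, E) 𝓘(ℝ) ∞ f) (hX : SmoothVectorField X) (x : M) :
    nijenhuis A (f • X) Y x = f x • nijenhuis A X Y x := by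
  have h : (fun y ↦ A y ((f • X) y)) = f • fun y ↦ A y (X y) := by
    ext y; simp
  have hfx : MDifferentiableAt 𝓘(ℝ, E) 𝓘(ℝ) f x := (hf x).mdifferentiableAt (by simp)
  simp only [nijenhuis, h]
  rw [mlieBracket_smul_left hfx (hX.mdifferentiableAt x),
    mlieBracket_smul_left hfx (hX.mdifferentiableAt x),
    mlieBracket_smul_left hfx ((hA X hX).mdifferentiableAt x),
    mlieBracket_smul_left hfx ((hA X hX).mdifferentiableAt x)]
  simp only [map_add, map_smul, map_neg, neg_smul]
  module

theorem mlieBracket_neg_left [CompleteSpace E] {X Y : Π x : M, TangentSpace 𝓘(ℝ, E) x}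
    (hX : SmoothVectorField X) (x : M) :
    mlieBracket 𝓘(ℝ, E) (-X) Y x = - mlieBracket 𝓘(ℝ, E) X Y x := by
  have h := mlieBracket_const_smul_left (c := (-1 : ℝ)) (W := Y) (hX.mdifferentiableAt x)
  simpa using h

end Geometry

/-! ### Reeb fields and horizontal fields -/

section ContactPair

open VectorField

variable {E : Type*} [NormedAddCommGroup E] [NormedSpace ℝ E]
  {M : Type*} [TopologicalSpace M] [ChartedSpace E M] [IsManifold 𝓘(ℝ, E) ∞ M]
  {α₁ α₂ : Π x : M, TangentSpace 𝓘(ℝ, E) x →L[ℝ] ℝ}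
  {φ : Π x : M, TangentSpace 𝓘(ℝ, E) x →L[ℝ] TangentSpace 𝓘(ℝ, E) x}
  {Z₁ Z₂ X Y : Π x : M, TangentSpace 𝓘(ℝ, E) x}

/-- The part of a contact pair structure that is symmetric in the two forms and does not involve
the volume form. -/
structure IsReebStructure (α₁ α₂ : Π x : M, TangentSpace 𝓘(ℝ, E) x →L[ℝ] ℝ)
    (φ : Π x : M, TangentSpace 𝓘(ℝ, E) x →L[ℝ] TangentSpace 𝓘(ℝ, E) x)
    (Z₁ Z₂ : Π x : M, TangentSpace 𝓘(ℝ, E) x) : Prop where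
  smooth₁ : SmoothOneForm α₁
  smooth₂ : SmoothOneForm α₂
  areReebFields : AreReebFields α₁ α₂ Z₁ Z₂
  smooth : SmoothEndo φ
  sq : ∀ (x : M) (v : TangentSpace 𝓘(ℝ, E) x),
    φ x (φ x v) = -v + α₁ x v • Z₁ x + α₂ x v • Z₂ x
  apply₁ : ∀ x : M, φ x (Z₁ x) = 0
  apply₂ : ∀ x : M, φ x (Z₂ x) = 0

theorem IsContactPairStructure.isReebStructure {h k : ℕ}
    (hs : IsContactPairStructure h k α₁ α₂ φ Z₁ Z₂) : IsReebStructure α₁ α₂ φ Z₁ Z₂ where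
  smooth₁ := hs.isContactPair.smooth₁
  smooth₂ := hs.isContactPair.smooth₂
  areReebFields := hs.areReebFields
  smooth := hs.smooth
  sq := hs.sq
  apply₁ := hs.apply₁
  apply₂ := hs.apply₂

/-- A smooth vector field in the common kernel of the two forms. -/
structure IsHorizontal (α₁ α₂ : Π x : M, TangentSpace 𝓘(ℝ, E) x →L[ℝ] ℝ)
    (X : Π x : M, TangentSpace 𝓘(ℝ, E) x) : Prop where
  smooth : SmoothVectorField X
  apply₁ : ∀ x, α₁ x (X x) = 0
  apply₂ : ∀ x, α₂ x (X x) = 0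

theorem IsHorizontal.symm (h : IsHorizontal α₁ α₂ X) : IsHorizontal α₂ α₁ X :=
  ⟨h.smooth, h.apply₂, h.apply₁⟩

theorem eq_zero_of_eq_neg {V : Type*} [AddCommGroup V] [Module ℝ V] {v : V} (h : v = -v) :
    v = 0 := by
  have h2 : (2 : ℝ) • v = 0 := by
    rw [two_smul]
    exact eq_neg_iff_add_eq_zero.1 h
  exact (smul_eq_zero_iff_right two_ne_zero).1 h2

omit [IsManifold 𝓘(ℝ, E) ∞ M] in
theorem associatedJ_apply (x : M) (v : TangentSpace 𝓘(ℝ, E) x) :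
    associatedJ α₁ α₂ φ Z₁ Z₂ x v = φ x v - α₂ x v • Z₁ x + α₁ x v • Z₂ x := by
  simp [associatedJ]

theorem IsHorizontal.associatedJ_eq (hX : IsHorizontal α₁ α₂ X) :
    (fun y ↦ associatedJ α₁ α₂ φ Z₁ Z₂ y (X y)) = fun y ↦ φ y (X y) := by
  ext y; simp [associatedJ_apply, hX.apply₁, hX.apply₂]

namespace IsReebStructure

/-- Exchanging the indices replaces `J` by `T`, so each statement about `J` has a version for `T`.
-/
theorem symm (h : IsReebStructure α₁ α₂ φ Z₁ Z₂) : IsReebStructure α₂ α₁ φ Z₂ Z₁ where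
  smooth₁ := h.smooth₂
  smooth₂ := h.smooth₁
  areReebFields :=
    { smooth₁ := h.areReebFields.smooth₂
      smooth₂ := h.areReebFields.smooth₁
      apply₁₁ := h.areReebFields.apply₂₂
      apply₂₂ := h.areReebFields.apply₁₁
      apply₁₂ := h.areReebFields.apply₂₁
      apply₂₁ := h.areReebFields.apply₁₂
      contract₁₁ := h.areReebFields.contract₂₂
      contract₁₂ := h.areReebFields.contract₂₁
      contract₂₁ := h.areReebFields.contract₁₂
      contract₂₂ := h.areReebFields.contract₁₁ }
  smooth := h.smooth
  sq x v := by rw [h.sq]; module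
  apply₁ := h.apply₂
  apply₂ := h.apply₁

/-- Computing `φ³v` as `φ²(φv)` and as `φ(φ²v)` gives `α₁(φv)Z₁ + α₂(φv)Z₂ = 0`. -/
theorem form_apply_endo₁ (h : IsReebStructure α₁ α₂ φ Z₁ Z₂) (x : M)
    (v : TangentSpace 𝓘(ℝ, E) x) : α₁ x (φ x v) = 0 := by
  have h1 := h.sq x (φ x v)
  rw [h.sq x v] at h1
  simp only [map_add, map_neg, map_smul, h.apply₁, h.apply₂, smul_zero, add_zero] at h1
  have h2 := congrArg (α₁ x) h1
  simp only [map_add, map_neg, map_smul, h.areReebFields.apply₁₁, h.areReebFields.apply₁₂,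
    smul_eq_mul] at h2
  linarith

theorem form_apply_endo₂ (h : IsReebStructure α₁ α₂ φ Z₁ Z₂) (x : M)
    (v : TangentSpace 𝓘(ℝ, E) x) : α₂ x (φ x v) = 0 := h.symm.form_apply_endo₁ x v

theorem isHorizontal_endo (h : IsReebStructure α₁ α₂ φ Z₁ Z₂) (hX : SmoothVectorField X) :
    IsHorizontal α₁ α₂ fun y ↦ φ y (X y) :=
  ⟨h.smooth.apply hX, fun _ ↦ h.form_apply_endo₁ _ _, fun _ ↦ h.form_apply_endo₂ _ _⟩

/-- The horizontal part of a vector field. -/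
theorem isHorizontal_neg_sq (h : IsReebStructure α₁ α₂ φ Z₁ Z₂) (hX : SmoothVectorField X) :
    IsHorizontal α₁ α₂ (-fun y ↦ φ y (φ y (X y))) where
  smooth := (h.smooth.apply (h.smooth.apply hX)).neg
  apply₁ x := by simp [h.form_apply_endo₁]
  apply₂ x := by simp [h.form_apply_endo₂]

theorem eq_horizontal_add (h : IsReebStructure α₁ α₂ φ Z₁ Z₂)
    (X : Π x : M, TangentSpace 𝓘(ℝ, E) x) :
    X = (-fun y ↦ φ y (φ y (X y))) + (fun y ↦ α₁ y (X y)) • Z₁ + (fun y ↦ α₂ y (X y)) • Z₂ := by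
  ext x
  simp only [Pi.add_apply, Pi.neg_apply, Pi.smul_apply', h.sq]
  module

theorem exists_isHorizontal_apply_eq [FiniteDimensional ℝ E] [T2Space M]
    (h : IsReebStructure α₁ α₂ φ Z₁ Z₂) (x : M)
    {v : TangentSpace 𝓘(ℝ, E) x} (h₁ : α₁ x v = 0) (h₂ : α₂ x v = 0) :
    ∃ X, IsHorizontal α₁ α₂ X ∧ X x = v := by
  obtain ⟨X, hX, rfl⟩ := exists_smoothVectorField_apply_eq x v
  exact ⟨_, h.isHorizontal_neg_sq hX, by simp [h.sq, h₁, h₂]⟩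

theorem smooth_associatedJ (h : IsReebStructure α₁ α₂ φ Z₁ Z₂) (hX : SmoothVectorField X) :
    SmoothVectorField fun y ↦ associatedJ α₁ α₂ φ Z₁ Z₂ y (X y) := by
  have e : (fun y ↦ associatedJ α₁ α₂ φ Z₁ Z₂ y (X y)) =
      (fun y ↦ φ y (X y)) + -((fun y ↦ α₂ y (X y)) • Z₁) + (fun y ↦ α₁ y (X y)) • Z₂ := by
    ext y
    simp [associatedJ_apply, sub_eq_add_neg]
  rw [e]
  exact ((h.smooth.apply hX).add (SmoothVectorField.smul (h.smooth₂.apply hX)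
    h.areReebFields.smooth₁).neg).add
      (SmoothVectorField.smul (h.smooth₁.apply hX) h.areReebFields.smooth₂)

theorem form₁_associatedJ (h : IsReebStructure α₁ α₂ φ Z₁ Z₂) (x : M)
    (v : TangentSpace 𝓘(ℝ, E) x) : α₁ x (associatedJ α₁ α₂ φ Z₁ Z₂ x v) = - α₂ x v := by
  simp [associatedJ_apply, h.form_apply_endo₁, h.areReebFields.apply₁₁, h.areReebFields.apply₁₂]

theorem form₂_associatedJ (h : IsReebStructure α₁ α₂ φ Z₁ Z₂) (x : M)
    (v : TangentSpace 𝓘(ℝ, E) x) : α₂ x (associatedJ α₁ α₂ φ Z₁ Z₂ x v) = α₁ x v := by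
  simp [associatedJ_apply, h.form_apply_endo₂, h.areReebFields.apply₂₁, h.areReebFields.apply₂₂]

theorem associatedJ_reeb₁ (h : IsReebStructure α₁ α₂ φ Z₁ Z₂) (x : M) :
    associatedJ α₁ α₂ φ Z₁ Z₂ x (Z₁ x) = Z₂ x := by
  simp [associatedJ_apply, h.apply₁, h.areReebFields.apply₁₁, h.areReebFields.apply₂₁]

theorem associatedJ_reeb₂ (h : IsReebStructure α₁ α₂ φ Z₁ Z₂) (x : M) :
    associatedJ α₁ α₂ φ Z₁ Z₂ x (Z₂ x) = - Z₁ x := by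
  simp [associatedJ_apply, h.apply₂, h.areReebFields.apply₁₂, h.areReebFields.apply₂₂]

theorem associatedJ_sq (h : IsReebStructure α₁ α₂ φ Z₁ Z₂) (x : M)
    (v : TangentSpace 𝓘(ℝ, E) x) :
    associatedJ α₁ α₂ φ Z₁ Z₂ x (associatedJ α₁ α₂ φ Z₁ Z₂ x v) = -v := by
  rw [associatedJ_apply, h.form₁_associatedJ, h.form₂_associatedJ, associatedJ_apply]
  simp only [map_add, map_sub, map_smul, h.apply₁, h.apply₂, h.sq, smul_zero]
  module

variable [FiniteDimensional ℝ E]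

/-- The bracket of a Reeb field with a horizontal field is horizontal. -/
theorem isHorizontal_mlieBracket₁ (h : IsReebStructure α₁ α₂ φ Z₁ Z₂)
    (hX : IsHorizontal α₁ α₂ X) : IsHorizontal α₁ α₂ (mlieBracket 𝓘(ℝ, E) Z₁ X) :=
  have : CompleteSpace E := FiniteDimensional.complete ℝ E
  have hr := h.areReebFields
  ⟨hr.smooth₁.mlieBracket hX.smooth,
    h.smooth₁.apply_mlieBracket_eq_zero hr.smooth₁ hX.smooth hr.apply₁₁ hX.apply₁ hr.contract₁₁,
    h.smooth₂.apply_mlieBracket_eq_zero hr.smooth₁ hX.smooth hr.apply₂₁ hX.apply₂ hr.contract₁₂⟩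

theorem isHorizontal_mlieBracket₂ (h : IsReebStructure α₁ α₂ φ Z₁ Z₂)
    (hX : IsHorizontal α₁ α₂ X) : IsHorizontal α₁ α₂ (mlieBracket 𝓘(ℝ, E) Z₂ X) :=
  (h.symm.isHorizontal_mlieBracket₁ hX.symm).symm

theorem isHorizontal_mlieBracket_reeb (h : IsReebStructure α₁ α₂ φ Z₁ Z₂) :
    IsHorizontal α₁ α₂ (mlieBracket 𝓘(ℝ, E) Z₁ Z₂) :=
  have : CompleteSpace E := FiniteDimensional.complete ℝ E
  have hr := h.areReebFields
  ⟨hr.smooth₁.mlieBracket hr.smooth₂,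
    h.smooth₁.apply_mlieBracket_eq_zero hr.smooth₁ hr.smooth₂ hr.apply₁₁ hr.apply₁₂ hr.contract₁₁,
    h.smooth₂.apply_mlieBracket_eq_zero hr.smooth₁ hr.smooth₂ hr.apply₂₁ hr.apply₂₂ hr.contract₁₂⟩

/-- For horizontal `Y`, the Jacobi identity writes `[[Z₁, Z₂], Y]` as a difference of iterated
brackets with Reeb fields, which are horizontal; so `dα₁([Z₁, Z₂], Y) = 0`. The Reeb directions are
covered by `i_{Z_j} dα₁ = 0`. -/
theorem curryLeft_mlieBracket_reeb₁ [T2Space M] (h : IsReebStructure α₁ α₂ φ Z₁ Z₂) (x : M) :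
    (dOneForm α₁ x).curryLeft (mlieBracket 𝓘(ℝ, E) Z₁ Z₂ x) = 0 := by
  have : CompleteSpace E := FiniteDimensional.complete ℝ E
  have : IsManifold 𝓘(ℝ, E) (minSmoothness ℝ 3) M := by
    simpa using inferInstanceAs (IsManifold 𝓘(ℝ, E) 3 M)
  have hr := h.areReebFields
  rw [AlternatingMap.curryLeft_eq_zero_iff]
  intro v
  obtain ⟨Y, hY, hYx⟩ := h.exists_isHorizontal_apply_eq x (v := -φ x (φ x v))
    (by simp [h.form_apply_endo₁]) (by simp [h.form_apply_endo₂])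
  have hv : v = Y x + α₁ x v • Z₁ x + α₂ x v • Z₂ x := by
    rw [hYx, h.sq]; module
  have hB := h.isHorizontal_mlieBracket_reeb
  have hle : minSmoothness ℝ 2 ≤ (∞ : WithTop ℕ∞) := by
    rw [minSmoothness_of_isRCLikeNormedField]
    exact ENat.LEInfty.out
  have hjac := leibniz_identity_mlieBracket_apply (I := 𝓘(ℝ, E)) (x := x)
    ((hr.smooth₁ x).of_le hle) ((hr.smooth₂ x).of_le hle)
    ((hY.smooth x).of_le hle)
  have h1 := congrArg (α₁ x) hjac
  rw [map_add, (h.isHorizontal_mlieBracket₁ (h.isHorizontal_mlieBracket₂ hY)).apply₁,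
    (h.isHorizontal_mlieBracket₂ (h.isHorizontal_mlieBracket₁ hY)).apply₁] at h1
  have h2 := dOneForm_bilin_of_const h.smooth₁ hB.smooth hY.smooth hB.apply₁ hY.apply₁ x
  have h3 : (dOneForm α₁ x).bilin (Z₁ x) (mlieBracket 𝓘(ℝ, E) Z₁ Z₂ x) = 0 :=
    ((dOneForm α₁ x).curryLeft_eq_zero_iff _).1 (hr.contract₁₁ x) _
  have h4 : (dOneForm α₁ x).bilin (Z₂ x) (mlieBracket 𝓘(ℝ, E) Z₁ Z₂ x) = 0 :=
    ((dOneForm α₁ x).curryLeft_eq_zero_iff _).1 (hr.contract₂₁ x) _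
  rw [hv, map_add, map_add, map_smul, map_smul, h2, (dOneForm α₁ x).bilin_swap (Z₁ x),
    (dOneForm α₁ x).bilin_swap (Z₂ x), h3, h4]
  simp only [neg_zero, smul_zero, add_zero]
  linarith

theorem curryLeft_mlieBracket_reeb₂ [T2Space M] (h : IsReebStructure α₁ α₂ φ Z₁ Z₂) (x : M) :
    (dOneForm α₂ x).curryLeft (mlieBracket 𝓘(ℝ, E) Z₁ Z₂ x) = 0 := by
  rw [mlieBracket_swap_apply, map_neg, h.symm.curryLeft_mlieBracket_reeb₁, neg_zero]

end IsReebStructure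

/-- The Reeb fields of a contact pair commute. -/
theorem IsContactPairStructure.mlieBracket_reeb_eq_zero [FiniteDimensional ℝ E] [T2Space M]
    {h k : ℕ} (hs : IsContactPairStructure h k α₁ α₂ φ Z₁ Z₂) (x : M) :
    mlieBracket 𝓘(ℝ, E) Z₁ Z₂ x = 0 :=
  have : FiniteDimensional ℝ (TangentSpace 𝓘(ℝ, E) x) := inferInstanceAs (FiniteDimensional ℝ E)
  have hr := hs.isReebStructure
  eq_zero_of_wedge_ne_zero hs.isContactPair.dim_eq (hs.isContactPair.volume_ne_zero x)
    (hr.isHorizontal_mlieBracket_reeb.apply₁ x) (hr.isHorizontal_mlieBracket_reeb.apply₂ x)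
    (hr.curryLeft_mlieBracket_reeb₁ x) (hr.curryLeft_mlieBracket_reeb₂ x)

/-! ### Nijenhuis tensors of the associated structures -/

namespace IsReebStructure

variable [FiniteDimensional ℝ E]

/-- All brackets in `N_J(Z₁, X)` are horizontal, so the outer `J` acts on them as `φ`, and `-[Z₁, X]
= φ²[Z₁, X]`. -/
theorem nijenhuis_reeb₁ (h : IsReebStructure α₁ α₂ φ Z₁ Z₂) (hX : IsHorizontal α₁ α₂ X) (x : M) :
    nijenhuis (associatedJ α₁ α₂ φ Z₁ Z₂) Z₁ X x =
      lieDerivEndo Z₂ φ X x - φ x (lieDerivEndo Z₁ φ X x) := by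
  have h1 := h.isHorizontal_mlieBracket₁ hX
  have h2 := h.isHorizontal_mlieBracket₂ hX
  have h3 := h.isHorizontal_mlieBracket₁ (h.isHorizontal_endo hX.smooth)
  simp only [nijenhuis, hX.associatedJ_eq, h.associatedJ_reeb₁, h.associatedJ_sq, lieDerivEndo,
    map_sub, h.sq]
  simp only [associatedJ_apply, h1.apply₁, h1.apply₂, h2.apply₁, h2.apply₂, h3.apply₁, h3.apply₂]
  module

theorem nijenhuis_reeb₂ (h : IsReebStructure α₁ α₂ φ Z₁ Z₂) (hX : IsHorizontal α₁ α₂ X) (x : M) :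
    nijenhuis (associatedJ α₁ α₂ φ Z₁ Z₂) Z₂ X x =
      -lieDerivEndo Z₁ φ X x - φ x (lieDerivEndo Z₂ φ X x) := by
  have : CompleteSpace E := FiniteDimensional.complete ℝ E
  have h1 := h.isHorizontal_mlieBracket₁ hX
  have h2 := h.isHorizontal_mlieBracket₂ hX
  have h3 := h.isHorizontal_mlieBracket₂ (h.isHorizontal_endo hX.smooth)
  have e : (fun y ↦ associatedJ α₁ α₂ φ Z₁ Z₂ y (Z₂ y)) = -Z₁ := by
    ext y; simp [h.associatedJ_reeb₂]
  simp only [nijenhuis, hX.associatedJ_eq, e, mlieBracket_neg_left h.areReebFields.smooth₁,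
    h.associatedJ_sq, lieDerivEndo, map_sub, map_neg, h.sq]
  simp only [associatedJ_apply, h1.apply₁, h1.apply₂, h2.apply₁, h2.apply₂, h3.apply₁, h3.apply₂]
  module

/-- Since `Z₂ = JZ₁` and `J² = -1`, the terms cancel by antisymmetry alone, without `[Z₁, Z₂] = 0`.
-/
theorem nijenhuis_reeb₁_reeb₂ (h : IsReebStructure α₁ α₂ φ Z₁ Z₂) (x : M) :
    nijenhuis (associatedJ α₁ α₂ φ Z₁ Z₂) Z₁ Z₂ x = 0 := by
  have : CompleteSpace E := FiniteDimensional.complete ℝ E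
  have e : (fun y ↦ associatedJ α₁ α₂ φ Z₁ Z₂ y (Z₂ y)) = -Z₁ := by
    ext y; simp [h.associatedJ_reeb₂]
  have e' : (fun y ↦ associatedJ α₁ α₂ φ Z₁ Z₂ y (Z₁ y)) = Z₂ := by
    ext y; simp [h.associatedJ_reeb₁]
  simp only [nijenhuis, e, e', h.associatedJ_sq]
  rw [mlieBracket_swap_apply (V := Z₂) (W := -Z₁), mlieBracket_swap_apply (V := Z₁) (W := -Z₁),
    mlieBracket_neg_left h.areReebFields.smooth₁, mlieBracket_neg_left h.areReebFields.smooth₁]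
  simp

/-- The difference of the Nijenhuis tensors of the two associated structures on horizontal
fields. -/
theorem nijenhuis_sub (h : IsReebStructure α₁ α₂ φ Z₁ Z₂) (hX : IsHorizontal α₁ α₂ X)
    (hY : IsHorizontal α₁ α₂ Y) (x : M) :
    nijenhuis (associatedJ α₂ α₁ φ Z₂ Z₁) X Y x - nijenhuis (associatedJ α₁ α₂ φ Z₁ Z₂) X Y x =
      (2 * ((dOneForm α₂ x).bilin (φ x (X x)) (Y x) + (dOneForm α₂ x).bilin (X x) (φ x (Y x)))) •
        Z₁ x -
      (2 * ((dOneForm α₁ x).bilin (φ x (X x)) (Y x) + (dOneForm α₁ x).bilin (X x) (φ x (Y x)))) •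
        Z₂ x := by
  have hφX := h.isHorizontal_endo hX.smooth
  have hφY := h.isHorizontal_endo hY.smooth
  have a1 := dOneForm_bilin_of_const h.smooth₁ hφX.smooth hY.smooth hφX.apply₁ hY.apply₁ x
  have a2 := dOneForm_bilin_of_const h.smooth₂ hφX.smooth hY.smooth hφX.apply₂ hY.apply₂ x
  have a3 := dOneForm_bilin_of_const h.smooth₁ hX.smooth hφY.smooth hX.apply₁ hφY.apply₁ x
  have a4 := dOneForm_bilin_of_const h.smooth₂ hX.smooth hφY.smooth hX.apply₂ hφY.apply₂ x
  rw [a1, a2, a3, a4]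
  -- Both structures act as `φ` on horizontal fields, so only the outer factor on `[φX, Y] + [X,
  -- φY]` differs, by `T - J = 2(α₂ ⊗ Z₁ - α₁ ⊗ Z₂)`.
  simp only [nijenhuis, hX.associatedJ_eq, hY.associatedJ_eq, hX.symm.associatedJ_eq,
    hY.symm.associatedJ_eq, h.associatedJ_sq, h.symm.associatedJ_sq]
  simp only [associatedJ_apply]
  module

/-- The components along the Reeb fields of the vanishing of the Nijenhuis tensor on horizontal
vectors. -/
theorem bilin_of_isIntegrable [T2Space M] (h : IsReebStructure α₁ α₂ φ Z₁ Z₂)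
    (hJ : IsIntegrable (associatedJ α₁ α₂ φ Z₁ Z₂)) (x : M) {u v : TangentSpace 𝓘(ℝ, E) x}
    (hu₁ : α₁ x u = 0) (hu₂ : α₂ x u = 0) (hv₁ : α₁ x v = 0) (hv₂ : α₂ x v = 0) :
    (dOneForm α₁ x).bilin u v - (dOneForm α₁ x).bilin (φ x u) (φ x v) =
      (dOneForm α₂ x).bilin (φ x u) v + (dOneForm α₂ x).bilin u (φ x v) ∧
    (dOneForm α₂ x).bilin u v - (dOneForm α₂ x).bilin (φ x u) (φ x v) =
      -((dOneForm α₁ x).bilin (φ x u) v + (dOneForm α₁ x).bilin u (φ x v)) := by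
  obtain ⟨X, hX, rfl⟩ := h.exists_isHorizontal_apply_eq x hu₁ hu₂
  obtain ⟨Y, hY, rfl⟩ := h.exists_isHorizontal_apply_eq x hv₁ hv₂
  have hφX := h.isHorizontal_endo hX.smooth
  have hφY := h.isHorizontal_endo hY.smooth
  have hN := hJ X Y hX.smooth hY.smooth x
  simp only [nijenhuis, hX.associatedJ_eq, hY.associatedJ_eq, h.associatedJ_sq] at hN
  have n1 := congrArg (α₁ x) hN
  have n2 := congrArg (α₂ x) hN
  simp only [map_add, map_sub, map_neg, h.form₁_associatedJ, h.form₂_associatedJ, map_zero]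
    at n1 n2
  rw [dOneForm_bilin_of_const h.smooth₁ hX.smooth hY.smooth hX.apply₁ hY.apply₁,
    dOneForm_bilin_of_const h.smooth₂ hX.smooth hY.smooth hX.apply₂ hY.apply₂,
    dOneForm_bilin_of_const h.smooth₁ hφX.smooth hY.smooth hφX.apply₁ hY.apply₁,
    dOneForm_bilin_of_const h.smooth₂ hφX.smooth hY.smooth hφX.apply₂ hY.apply₂,
    dOneForm_bilin_of_const h.smooth₁ hX.smooth hφY.smooth hX.apply₁ hφY.apply₁,
    dOneForm_bilin_of_const h.smooth₂ hX.smooth hφY.smooth hX.apply₂ hφY.apply₂,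
    dOneForm_bilin_of_const h.smooth₁ hφX.smooth hφY.smooth hφX.apply₁ hφY.apply₁,
    dOneForm_bilin_of_const h.smooth₂ hφX.smooth hφY.smooth hφX.apply₂ hφY.apply₂]
  constructor <;> linarith

/-- For a decomposable structure with integrable `J`, the endomorphism `φ` is skew for both exterior
derivatives on horizontal vectors. -/
theorem bilin_add_eq_zero [T2Space M] (h : IsReebStructure α₁ α₂ φ Z₁ Z₂)
    (hJ : IsIntegrable (associatedJ α₁ α₂ φ Z₁ Z₂)) (hdec : IsDecomposable α₁ α₂ φ) (x : M)
    (hsup : charDistribution α₁ x ⊔ charDistribution α₂ x = ⊤) {u v : TangentSpace 𝓘(ℝ, E) x}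
    (hu₁ : α₁ x u = 0) (hu₂ : α₂ x u = 0) (hv₁ : α₁ x v = 0) (hv₂ : α₂ x v = 0) :
    (dOneForm α₁ x).bilin (φ x u) v + (dOneForm α₁ x).bilin u (φ x v) = 0 ∧
      (dOneForm α₂ x).bilin (φ x u) v + (dOneForm α₂ x).bilin u (φ x v) = 0 := by
  obtain ⟨u₁, m₁, u₂, m₂, rfl⟩ := Submodule.mem_sup.1 (hsup ▸ Submodule.mem_top (x := u))
  have c₁ : ∀ w ∈ charDistribution α₁ x, α₁ x w = 0 ∧ ∀ z, (dOneForm α₁ x).bilin w z = 0 :=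
    fun w hw ↦ ⟨hw.1, ((dOneForm α₁ x).curryLeft_eq_zero_iff w).1 hw.2⟩
  have c₂ : ∀ w ∈ charDistribution α₂ x, α₂ x w = 0 ∧ ∀ z, (dOneForm α₂ x).bilin w z = 0 :=
    fun w hw ↦ ⟨hw.1, ((dOneForm α₂ x).curryLeft_eq_zero_iff w).1 hw.2⟩
  have d₁ := c₁ _ ((hdec x).1 u₁ m₁)
  have d₂ := c₂ _ ((hdec x).2 u₂ m₂)
  have p₁ := c₁ _ m₁
  have p₂ := c₂ _ m₂
  -- As `α_i(u_i) = 0`, horizontality of `u₁ + u₂` passes to each summand.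
  rw [map_add, p₁.1, zero_add] at hu₁
  rw [map_add, p₂.1, add_zero] at hu₂
  -- The left side of each identity vanishes on its characteristic space, which `φ` preserves: `u₁`
  -- yields the `dα₂` relation and `u₂` the `dα₁` relation. The other contributions are zero.
  have q₁ := (h.bilin_of_isIntegrable hJ x p₁.1 hu₂ hv₁ hv₂).1
  have q₂ := (h.bilin_of_isIntegrable hJ x hu₁ p₂.1 hv₁ hv₂).2
  simp only [map_add, LinearMap.add_apply, d₁.2, d₂.2, p₁.2, p₂.2] at q₁ q₂ ⊢
  constructor <;> linarith

/-- As the Reeb fields commute, the bracket of `Z₁` with `f₁Z₁ + f₂Z₂` is again a combination of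
them, which `φ` kills; only the horizontal part of a field contributes. -/
theorem lieDerivEndoVanishes₁_iff (h : IsReebStructure α₁ α₂ φ Z₁ Z₂)
    (hcomm : ∀ x, mlieBracket 𝓘(ℝ, E) Z₁ Z₂ x = 0) :
    LieDerivEndoVanishes Z₁ φ ↔
      ∀ X, IsHorizontal α₁ α₂ X → ∀ x, lieDerivEndo Z₁ φ X x = 0 := by
  have : CompleteSpace E := FiniteDimensional.complete ℝ E
  have hr := h.areReebFields
  refine ⟨fun H X hX ↦ H X hX.smooth, fun H X hX x ↦ ?_⟩
  have hH := h.isHorizontal_neg_sq hX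
  have f₁ := h.smooth₁.apply hX
  have f₂ := h.smooth₂.apply hX
  have s₁ := SmoothVectorField.smul f₁ hr.smooth₁
  have s₂ := SmoothVectorField.smul f₂ hr.smooth₂
  have e : (fun y ↦ φ y (X y)) = fun y ↦ φ y ((-fun y ↦ φ y (φ y (X y))) y) := by
    ext y
    simp [h.sq, h.apply₁, h.apply₂]
  have hb : φ x (mlieBracket 𝓘(ℝ, E) Z₁ X x) =
      φ x (mlieBracket 𝓘(ℝ, E) Z₁ (-fun y ↦ φ y (φ y (X y))) x) := by
    conv_lhs => rw [h.eq_horizontal_add X]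
    rw [mlieBracket_add_right ((hH.smooth.add s₁).mdifferentiableAt x) (s₂.mdifferentiableAt x),
      mlieBracket_add_right (hH.smooth.mdifferentiableAt x) (s₁.mdifferentiableAt x),
      mlieBracket_smul_right ((f₁ x).mdifferentiableAt (by simp)) (hr.smooth₁.mdifferentiableAt x),
      mlieBracket_smul_right ((f₂ x).mdifferentiableAt (by simp)) (hr.smooth₂.mdifferentiableAt x),
      hcomm, mlieBracket_self]
    simp only [map_add, map_smul, h.apply₁, h.apply₂, Pi.zero_apply, smul_zero, add_zero]
  rw [lieDerivEndo, hb, e]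
  exact H _ hH x

/-- The Nijenhuis tensor is linear over functions and antisymmetric, and every field is a horizontal
one plus a combination of Reeb fields. -/
theorem isIntegrable_of_horizontal (h : IsReebStructure α₁ α₂ φ Z₁ Z₂)
    (h₁ : ∀ X, IsHorizontal α₁ α₂ X → ∀ x, nijenhuis (associatedJ α₁ α₂ φ Z₁ Z₂) Z₁ X x = 0)
    (h₂ : ∀ X, IsHorizontal α₁ α₂ X → ∀ x, nijenhuis (associatedJ α₁ α₂ φ Z₁ Z₂) Z₂ X x = 0)
    (h₃ : ∀ X Y, IsHorizontal α₁ α₂ X → IsHorizontal α₁ α₂ Y →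
      ∀ x, nijenhuis (associatedJ α₁ α₂ φ Z₁ Z₂) X Y x = 0) :
    IsIntegrable (associatedJ α₁ α₂ φ Z₁ Z₂) := by
  have : CompleteSpace E := FiniteDimensional.complete ℝ E
  have hr := h.areReebFields
  -- linearity in the left argument
  have key (Y : Π x : M, TangentSpace 𝓘(ℝ, E) x) (x : M)
      (k₁ : nijenhuis (associatedJ α₁ α₂ φ Z₁ Z₂) Z₁ Y x = 0)
      (k₂ : nijenhuis (associatedJ α₁ α₂ φ Z₁ Z₂) Z₂ Y x = 0)
      (k₃ : ∀ X, IsHorizontal α₁ α₂ X → nijenhuis (associatedJ α₁ α₂ φ Z₁ Z₂) X Y x = 0)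
      (X : Π x : M, TangentSpace 𝓘(ℝ, E) x) (hX : SmoothVectorField X) :
      nijenhuis (associatedJ α₁ α₂ φ Z₁ Z₂) X Y x = 0 := by
    have hA := fun X (hX : SmoothVectorField X) ↦ h.smooth_associatedJ hX
    have hH := h.isHorizontal_neg_sq hX
    have f₁ := h.smooth₁.apply hX
    have f₂ := h.smooth₂.apply hX
    have s₁ := SmoothVectorField.smul f₁ hr.smooth₁
    have s₂ := SmoothVectorField.smul f₂ hr.smooth₂
    rw [h.eq_horizontal_add X, nijenhuis_add_left hA (hH.smooth.add s₁) s₂,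
      nijenhuis_add_left hA hH.smooth s₁, nijenhuis_smul_left hA f₁ hr.smooth₁,
      nijenhuis_smul_left hA f₂ hr.smooth₂, k₁, k₂, k₃ _ hH, smul_zero, smul_zero, add_zero,
      add_zero]
  have hswap {X Y : Π x : M, TangentSpace 𝓘(ℝ, E) x} {x : M}
      (H : nijenhuis (associatedJ α₁ α₂ φ Z₁ Z₂) X Y x = 0) :
      nijenhuis (associatedJ α₁ α₂ φ Z₁ Z₂) Y X x = 0 := by
    rw [nijenhuis_swap, H, neg_zero]
  have hself (Z : Π x : M, TangentSpace 𝓘(ℝ, E) x) (x : M) :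
      nijenhuis (associatedJ α₁ α₂ φ Z₁ Z₂) Z Z x = 0 :=
    eq_zero_of_eq_neg (nijenhuis_swap _ Z Z x)
  have h12 := h.nijenhuis_reeb₁_reeb₂
  intro X Y hX hY x
  refine key Y x ?_ ?_ (fun X' hX' ↦ ?_) X hX
  · exact hswap (key Z₁ x (hself _ x) (hswap (h12 x)) (fun X' hX' ↦ hswap (h₁ X' hX' x)) Y hY)
  · exact hswap (key Z₂ x (h12 x) (hself _ x) (fun X' hX' ↦ hswap (h₂ X' hX' x)) Y hY)
  · exact hswap (key X' x (h₁ X' hX' x) (h₂ X' hX' x) (fun Y' hY' ↦ h₃ Y' X' hY' hX' x) Y hY)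

end IsReebStructure

end ContactPair

/-! ### The equivalence -/

theorem mainTheorem8 {E : Type*} [NormedAddCommGroup E] [NormedSpace ℝ E]
    [FiniteDimensional ℝ E]
    {M : Type*} [TopologicalSpace M] [T2Space M] [ChartedSpace E M] [IsManifold 𝓘(ℝ, E) ∞ M]
    (h k : ℕ)
    (α₁ α₂ : Π x : M, TangentSpace 𝓘(ℝ, E) x →L[ℝ] ℝ)
    (φ : Π x : M, TangentSpace 𝓘(ℝ, E) x →L[ℝ] TangentSpace 𝓘(ℝ, E) x)
    (Z₁ Z₂ : Π x : M, TangentSpace 𝓘(ℝ, E) x)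
    (hstr : IsContactPairStructure h k α₁ α₂ φ Z₁ Z₂)
    (hdec : IsDecomposable α₁ α₂ φ)
    (hJ : IsIntegrable (associatedJ α₁ α₂ φ Z₁ Z₂)) :
    List.TFAE [
      -- the almost complex structure `T` associated to `(α₂, α₁, φ)` is integrable
      IsIntegrable (associatedJ α₂ α₁ φ Z₂ Z₁),
      LieDerivEndoVanishes Z₁ φ,
      LieDerivEndoVanishes Z₂ φ] := by
  have h := hstr.isReebStructure
  have hcomm := hstr.mlieBracket_reeb_eq_zero
  have hcomm' (x : M) : VectorField.mlieBracket 𝓘(ℝ, E) Z₂ Z₁ x = 0 := by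
    rw [VectorField.mlieBracket_swap_apply, hcomm, neg_zero]
  have hL₁ := h.lieDerivEndoVanishes₁_iff hcomm
  have hL₂ := h.symm.lieDerivEndoVanishes₁_iff hcomm'
  have hJ₁ (X) (hX : IsHorizontal α₁ α₂ X) (x : M) :
      lieDerivEndo Z₂ φ X x = φ x (lieDerivEndo Z₁ φ X x) :=
    sub_eq_zero.1 ((h.nijenhuis_reeb₁ hX x).symm.trans
      (hJ Z₁ X h.areReebFields.smooth₁ hX.smooth x))
  have hJ₂ (X) (hX : IsHorizontal α₁ α₂ X) (x : M) :
      -lieDerivEndo Z₁ φ X x = φ x (lieDerivEndo Z₂ φ X x) :=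
    sub_eq_zero.1 ((h.nijenhuis_reeb₂ hX x).symm.trans
      (hJ Z₂ X h.areReebFields.smooth₂ hX.smooth x))
  tfae_have 2 → 3 := fun H ↦ hL₂.2 fun X hX x ↦ by
    rw [hJ₁ X hX.symm, hL₁.1 H X hX.symm, map_zero]
  tfae_have 3 → 2 := fun H ↦ hL₁.2 fun X hX x ↦ by
    rw [← neg_eq_zero, hJ₂ X hX, hL₂.1 H X hX.symm, map_zero]
  tfae_have 1 → 2 := fun H ↦ hL₁.2 fun X hX x ↦ by
    -- `Z₁` is the second Reeb field of the exchanged pair, so `N_T(Z₁, X)` carries the sign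
    -- opposite to that in `hJ₁`.
    have hT : -lieDerivEndo Z₂ φ X x = φ x (lieDerivEndo Z₁ φ X x) :=
      sub_eq_zero.1 ((h.symm.nijenhuis_reeb₂ hX.symm x).symm.trans
        (H Z₁ X h.areReebFields.smooth₁ hX.smooth x))
    have h0 : lieDerivEndo Z₂ φ X x = 0 := eq_zero_of_eq_neg ((hJ₁ X hX x).trans hT.symm)
    rw [← neg_eq_zero, hJ₂ X hX, h0, map_zero]
  tfae_have 2 → 1 := fun H ↦ by
    have H₁ := hL₁.1 H
    have H₂ (X) (hX : IsHorizontal α₁ α₂ X) (x : M) : lieDerivEndo Z₂ φ X x = 0 := by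
      rw [hJ₁ X hX, H₁ X hX, map_zero]
    refine h.symm.isIntegrable_of_horizontal (fun X hX x ↦ ?_) (fun X hX x ↦ ?_)
      (fun X Y hX hY x ↦ ?_)
    · rw [h.symm.nijenhuis_reeb₁ hX, H₁ X hX.symm, H₂ X hX.symm, map_zero, sub_zero]
    · rw [h.symm.nijenhuis_reeb₂ hX, H₁ X hX.symm, H₂ X hX.symm, map_zero, neg_zero, sub_zero]
    · have : FiniteDimensional ℝ (TangentSpace 𝓘(ℝ, E) x) :=
        inferInstanceAs (FiniteDimensional ℝ E)
      have hsup : charDistribution α₁ x ⊔ charDistribution α₂ x = ⊤ :=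
        char_sup_char_eq_top hstr.isContactPair.dim_eq (hstr.isContactPair.volume_ne_zero x)
          (hstr.isContactPair.pow₁ x) (hstr.isContactPair.pow₂ x)
      have hb := h.bilin_add_eq_zero hJ hdec x hsup (hX.apply₂ x) (hX.apply₁ x) (hY.apply₂ x)
        (hY.apply₁ x)
      -- With `hb`, the tensors of `T` and `J` coincide on horizontal fields.
      have hN := h.nijenhuis_sub hX.symm hY.symm x
      rwa [hb.1, hb.2, hJ X Y hX.smooth hY.smooth, mul_zero, zero_smul, zero_smul, sub_zero,
        sub_zero] at hN
  tfae_finish
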